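/- Let $M$ be a germ at $x=0$ of meromorphic bundle with connection, i.e. a finite-dimensional vector space over $\mathbb C\{x\}[x^{-1}]$ with an action of $\partial_x$ satisfying the Leibniz rule. Let $V^\bullet M$ denote its Deligne filtration: the unique exhaustive decreasing filtration indexed by $\mathbb R$, with discrete jumps, by $\mathbb C\{x\}\langle x\partial_x\rangle$-submodules of finite type, such that $x V^bM=V^{b+1}M$ and such that $V^bM/V^{>b}M$ is finite-dimensional over $\mathbb C$ with all eigenvalues of $x\partial_x$ having real part $b$ (where $V^{>b}=\bigcup_{b'>b}V^{b'}$). The Deligne filtration of a finite-dimensional $\mathbb C((y))$-vector space with connection is defined in the same way, with $\mathbb C[[y]]$ and $y\partial_y$ in place of $\mathbb C\{x\}$ and $x\partial_x$. Let $q\ge 1$ and let $\pi:y\mapsto x=y^q$ be a ramification such that the formalized pull-back $\widehat N=\mathbb C((y))\otimes_{\mathbb C\{x\}[x^{-1}]}M$ (on which $y\partial_y$ acts by $y\partial_y(g\otimes m)=yg'\otimes m+g\otimes q\,x\partial_xm$) admits a decomposition $\widehat N\simeq\bigoplus_{\varphi\in\Phi}(E^\varphi\otimes R_\varphi)$, with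 $\Phi\subset y^{-1}\mathbb C[y^{-1}]$ finite, $E^\varphi=(\mathbb C((y)),d+d\varphi)$, and each $R_\varphi$ a finite-dimensional $\mathbb C((y))$-vector space with a regular singular connection. For $b\in\mathbb R$ put $P^b(\widehat N)=\bigoplus_{\varphi\in\Phi}(E^\varphi\otimes V^bR_\varphi)$, let $P^b(M)=\{m\in M : 1\otimes m\in P^{qb}(\widehat N)\}$ be the canonical parabolic filtration of $M$ (equivalently, the $\mathbb Z/q\mathbb Z$-invariants of $P^{qb}(\widehat N)\cap\pi^+M$, where $(\pi^+M)^{\mathbb Z/q\mathbb Z}$ is identified with $M$), and put $P^{>b}(M)=\bigcup_{b'>b}P^{b'}(M)$. Then the minimal extension $M_{\min}:=\mathbb C\{x\}\langle\partial_x\rangle\cdot V^{>-1}(M)$ satisfies $M_{\min}=\mathbb C\{x\}\langle\partial_x\rangle\cdot P^{>-1}(M)$. -/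

import Mathlib

open scoped LaurentSeries PowerSeries TensorProduct

noncomputable section

namespace MeroConn

/-! ### Formal and convergent Laurent series -/

/-- The field `ℂ((x))` of formal Laurent series (a copy of Mathlib's `ℂ⸨X⸩`, on which the
`ℂ`-algebra structure is the coefficientwise one). -/
def Laurent : Type := ℂ⸨X⸩

instance : Field Laurent := inferInstanceAs (Field ℂ⸨X⸩)

instance : Algebra ℂ Laurent := HahnSeries.instAlgebra

/-- The inclusion `ℂ[[x]] → ℂ((x))`. -/
def ofPS : ℂ⟦X⟧ →ₐ[ℂ] Laurent := HahnSeries.ofPowerSeriesAlg ℤ ℂ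

/-- The coefficient of `x ^ n`. -/
def Laurent.coeff (f : Laurent) (n : ℤ) : ℂ := HahnSeries.coeff (f : ℂ⸨X⸩) n

@[ext]
theorem Laurent.ext {f g : Laurent} (h : ∀ n, f.coeff n = g.coeff n) : f = g :=
  HahnSeries.ext (funext h)

/-- The coordinate `x`. -/
def Laurent.x : Laurent := ofPS PowerSeries.X

/-- The derivation `d/dx` of `ℂ((x))`. -/
def Laurent.deriv : Laurent →ₗ[ℂ] Laurent where
  toFun f := LaurentSeries.derivative ℂ (f : ℂ⸨X⸩)
  map_add' f g := map_add (LaurentSeries.derivative ℂ) (f : ℂ⸨X⸩) g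
  map_smul' c f := map_smul (LaurentSeries.derivative ℂ) c (f : ℂ⸨X⸩)

/-- The derivation `x d/dx` of `ℂ((x))`. -/
def Laurent.euler : Laurent →ₗ[ℂ] Laurent :=
  LinearMap.mulLeft ℂ Laurent.x ∘ₗ Laurent.deriv

theorem Laurent.coeff_add (f g : Laurent) (n : ℤ) : (f + g).coeff n = f.coeff n + g.coeff n :=
  rfl

theorem Laurent.x_eq : Laurent.x = (HahnSeries.single 1 1 : ℂ⸨X⸩) :=
  HahnSeries.ofPowerSeries_X

theorem Laurent.coeff_euler (f : Laurent) (n : ℤ) : f.euler.coeff n = n * f.coeff n := by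
  have h : f.euler.coeff n =
      HahnSeries.coeff ((HahnSeries.single 1 1 : ℂ⸨X⸩) * LaurentSeries.derivative ℂ (f : ℂ⸨X⸩))
        ((n - 1) + 1) := by
    rw [sub_add_cancel]
    change HahnSeries.coeff (Laurent.x * _ : Laurent) n = _
    rw [Laurent.x_eq]; rfl
  rw [h, HahnSeries.coeff_single_mul_add, one_mul]
  refine (LaurentSeries.hasseDeriv_coeff (R := ℂ) 1 (f : ℂ⸨X⸩) (n - 1)).trans ?_
  simp [Laurent.coeff]

theorem Laurent.euler_mul (f g : Laurent) : (f * g).euler = f.euler * g + f * g.euler := by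
  have hf : HahnSeries.support (f.euler : ℂ⸨X⸩) ⊆ HahnSeries.support (f : ℂ⸨X⸩) := by
    intro n hn h0
    exact hn (by change f.euler.coeff n = 0; rw [coeff_euler]; change f.coeff n = 0 at h0; simp [h0])
  have hg : HahnSeries.support (g.euler : ℂ⸨X⸩) ⊆ HahnSeries.support (g : ℂ⸨X⸩) := by
    intro n hn h0
    exact hn (by change g.euler.coeff n = 0; rw [coeff_euler]; change g.coeff n = 0 at h0; simp [h0])
  ext n
  rw [coeff_euler, coeff_add]
  have e1 : (f * g).coeff n = _ := HahnSeries.coeff_mul (x := (f : ℂ⸨X⸩)) (y := (g : ℂ⸨X⸩)) (a := n)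
  have e2 : (f.euler * g).coeff n = _ := HahnSeries.coeff_mul_left' (x := (f.euler : ℂ⸨X⸩))
    (y := (g : ℂ⸨X⸩)) (a := n) (HahnSeries.isPWO_support _) hf
  have e3 : (f * g.euler).coeff n = _ := HahnSeries.coeff_mul_right' (x := (f : ℂ⸨X⸩))
    (y := (g.euler : ℂ⸨X⸩)) (a := n) (HahnSeries.isPWO_support _) hg
  rw [e1, e2, e3, Finset.mul_sum, ← Finset.sum_add_distrib]
  refine Finset.sum_congr rfl fun p hp => ?_
  have hp' := (Finset.mem_antidiagonal.1 hp).2.2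
  have a1 : HahnSeries.coeff (f.euler : ℂ⸨X⸩) p.1 = p.1 * HahnSeries.coeff (f : ℂ⸨X⸩) p.1 :=
    coeff_euler f p.1
  have a2 : HahnSeries.coeff (g.euler : ℂ⸨X⸩) p.2 = p.2 * HahnSeries.coeff (g : ℂ⸨X⸩) p.2 :=
    coeff_euler g p.2
  rw [a1, a2, ← hp']
  push_cast
  ring

/-- The ring `ℂ{x}` of convergent power series. -/
def convPS : Subalgebra ℂ ℂ⟦X⟧ where
  carrier := {f | ∃ r : ℝ, 0 < r ∧ Summable fun n : ℕ => ‖PowerSeries.coeff n f‖ * r ^ n}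
  mul_mem' := by
    rintro f g ⟨r, hr, hf⟩ ⟨s, hs, hg⟩
    have key : ∀ (h : ℂ⟦X⟧) (u v : ℝ), 0 < v → v ≤ u →
        (Summable fun n : ℕ => ‖PowerSeries.coeff n h‖ * u ^ n) →
        Summable fun n : ℕ => ‖PowerSeries.coeff n h * (v : ℂ) ^ n‖ := by
      intro h u v hv huv H
      refine Summable.of_nonneg_of_le (fun n => norm_nonneg _) (fun n => ?_) H
      rw [norm_mul, norm_pow, Complex.norm_real, Real.norm_of_nonneg hv.le]
      gcongr
    have hm : 0 < min r s := lt_min hr hs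
    refine ⟨min r s, hm, ?_⟩
    refine (summable_norm_sum_mul_antidiagonal_of_summable_norm
      (key f r _ hm (min_le_left _ _) hf) (key g s _ hm (min_le_right _ _) hg)).congr fun n => ?_
    rw [PowerSeries.coeff_mul, ← Real.norm_of_nonneg (pow_nonneg hm.le n), ← Complex.norm_real,
      ← norm_mul, Finset.sum_mul]
    congr 1
    refine Finset.sum_congr rfl fun p hp => ?_
    rw [← Finset.HasAntidiagonal.mem_antidiagonal.1 hp]
    push_cast
    ring
  add_mem' := by
    rintro f g ⟨r, hr, hf⟩ ⟨s, hs, hg⟩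
    have hm : 0 < min r s := lt_min hr hs
    refine ⟨min r s, hm, Summable.of_nonneg_of_le (fun n => by positivity) (fun n => ?_)
      (hf.add hg)⟩
    calc ‖PowerSeries.coeff n (f + g)‖ * min r s ^ n
        ≤ (‖PowerSeries.coeff n f‖ + ‖PowerSeries.coeff n g‖) * min r s ^ n := by
          rw [map_add]; gcongr; exact norm_add_le _ _
      _ ≤ ‖PowerSeries.coeff n f‖ * r ^ n + ‖PowerSeries.coeff n g‖ * s ^ n := by
          rw [add_mul]
          gcongr
          · exact min_le_left _ _
          · exact min_le_right _ _
  algebraMap_mem' c := by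
    refine ⟨1, one_pos, summable_of_ne_finset_zero (s := {0}) fun n hn => ?_⟩
    have hn' : n ≠ 0 := by simpa using hn
    rw [PowerSeries.algebraMap_apply, PowerSeries.coeff_C, if_neg hn']
    simp

theorem X_mem_convPS : (PowerSeries.X : ℂ⟦X⟧) ∈ convPS := by
  refine ⟨1, one_pos, summable_of_ne_finset_zero (s := {1}) fun n hn => ?_⟩
  have hn' : n ≠ 1 := by simpa using hn
  rw [PowerSeries.coeff_X, if_neg hn']
  simp

theorem euler_mem_convPS {f : ℂ⟦X⟧} (hf : f ∈ convPS) :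
    PowerSeries.mk (fun n => (n : ℂ) * PowerSeries.coeff n f) ∈ convPS := by
  obtain ⟨r, hr, hs⟩ := hf
  refine ⟨r / 2, by positivity, Summable.of_nonneg_of_le (fun n => by positivity) (fun n => ?_) hs⟩
  rw [PowerSeries.coeff_mk, norm_mul, Complex.norm_natCast, div_pow]
  have h2 : (n : ℝ) ≤ 2 ^ n := by exact_mod_cast Nat.lt_two_pow_self.le
  have : (n : ℝ) / 2 ^ n ≤ 1 := (div_le_one (by positivity)).2 h2
  calc (n : ℝ) * ‖PowerSeries.coeff n f‖ * (r ^ n / 2 ^ n)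
      = (n : ℝ) / 2 ^ n * (‖PowerSeries.coeff n f‖ * r ^ n) := by ring
    _ ≤ 1 * (‖PowerSeries.coeff n f‖ * r ^ n) := by gcongr
    _ = _ := one_mul _

theorem coeff_ofPS_natCast (f : ℂ⟦X⟧) (n : ℕ) : (ofPS f).coeff n = PowerSeries.coeff n f :=
  HahnSeries.ofPowerSeries_apply_coeff f n

theorem coeff_ofPS_of_neg (f : ℂ⟦X⟧) {n : ℤ} (hn : n < 0) : (ofPS f).coeff n = 0 := by
  change HahnSeries.coeff (HahnSeries.ofPowerSeries ℤ ℂ f) n = 0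
  rw [HahnSeries.ofPowerSeries_apply, HahnSeries.embDomain_of_notMem_range]
  rintro ⟨m, hm⟩
  simp at hm
  lia

theorem euler_ofPS (f : ℂ⟦X⟧) :
    (ofPS f).euler = ofPS (PowerSeries.mk fun n => (n : ℂ) * PowerSeries.coeff n f) := by
  ext n
  rw [Laurent.coeff_euler]
  rcases lt_or_ge n 0 with hn | hn
  · rw [coeff_ofPS_of_neg _ hn, coeff_ofPS_of_neg _ hn, mul_zero]
  · lift n to ℕ using hn
    rw [coeff_ofPS_natCast, coeff_ofPS_natCast, PowerSeries.coeff_mk]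
    simp

/-- The field `ℂ{x}[1/x]` of convergent Laurent series, inside `ℂ((x))`. -/
def ConvLaurent : Subalgebra ℂ Laurent where
  carrier := {f | ∃ k : ℕ, ∃ g ∈ convPS, Laurent.x ^ k * f = ofPS g}
  mul_mem' := by
    rintro f₁ f₂ ⟨k, g, hg, h⟩ ⟨l, g', hg', h'⟩
    exact ⟨k + l, g * g', mul_mem hg hg', by rw [map_mul, ← h, ← h']; ring⟩
  add_mem' := by
    rintro f₁ f₂ ⟨k, g, hg, h⟩ ⟨l, g', hg', h'⟩
    refine ⟨k + l, PowerSeries.X ^ l * g + PowerSeries.X ^ k * g',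
      add_mem (mul_mem (pow_mem X_mem_convPS _) hg) (mul_mem (pow_mem X_mem_convPS _) hg'), ?_⟩
    rw [map_add, map_mul, map_mul, map_pow, map_pow, ← h, ← h']
    change _ = Laurent.x ^ l * _ + Laurent.x ^ k * _
    ring
  algebraMap_mem' c := ⟨0, algebraMap ℂ _ c, convPS.algebraMap_mem c, by
    rw [pow_zero, one_mul, AlgHom.commutes]⟩

/-- The subring `ℂ{x}` of `ℂ{x}[1/x]`. -/
def convIntegers : Subalgebra ℂ ConvLaurent := (convPS.map ofPS).comap ConvLaurent.val

/-- The coordinate `x` as an element of `ℂ{x}[1/x]`. -/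
def ConvLaurent.x : ConvLaurent :=
  ⟨Laurent.x, 0, PowerSeries.X, X_mem_convPS, by rw [pow_zero, one_mul]; rfl⟩

theorem Laurent.x_ne_zero : Laurent.x ≠ 0 := by
  intro h
  have h1 : Laurent.x.coeff ((1 : ℕ) : ℤ) = 1 := by
    rw [Laurent.x, coeff_ofPS_natCast, PowerSeries.coeff_one_X]
  rw [h] at h1
  exact zero_ne_one h1

theorem Laurent.euler_x_pow (k : ℕ) : (Laurent.x ^ k).euler = k * Laurent.x ^ k := by
  have h1 : Laurent.x.euler = Laurent.x := by
    rw [Laurent.x, euler_ofPS]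
    congr 1
    ext n
    rw [PowerSeries.coeff_mk, PowerSeries.coeff_X]
    split_ifs with h <;> simp [h]
  induction k with
  | zero =>
    have := Laurent.euler_mul 1 1
    simp only [mul_one, one_mul, left_eq_add] at this
    simp [this]
  | succ k ih => rw [pow_succ, Laurent.euler_mul, ih, h1]; push_cast; ring

theorem deriv_mem {f : Laurent} (hf : f ∈ ConvLaurent) : f.deriv ∈ ConvLaurent := by
  obtain ⟨k, g, hg, h⟩ := hf
  refine ⟨k + 1, PowerSeries.mk (fun n => (n : ℂ) * PowerSeries.coeff n g) - k * g,
    sub_mem (euler_mem_convPS hg) (mul_mem (natCast_mem _ k) hg), ?_⟩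
  have h1 := congrArg Laurent.euler h
  rw [Laurent.euler_mul, Laurent.euler_x_pow, euler_ofPS] at h1
  rw [map_sub, ← h1, map_mul, map_natCast, ← h]
  change _ = k * Laurent.x ^ k * f + Laurent.x ^ k * (Laurent.x * f.deriv) - _
  ring

/-- The derivation `d/dx` of `ℂ{x}[1/x]`. -/
def ConvLaurent.deriv : ConvLaurent →ₗ[ℂ] ConvLaurent :=
  Laurent.deriv.restrict (p := Subalgebra.toSubmodule ConvLaurent)
    (q := Subalgebra.toSubmodule ConvLaurent) fun _ hf => deriv_mem hf

/-! ### The ramification `y ↦ x = y ^ q` -/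

/-- The field `ℂ((y))`, regarded as an extension of `ℂ{x}[1/x]` through `x = y ^ q`. -/
def Ram (_q : ℕ+) : Type := Laurent

instance (q : ℕ+) : Field (Ram q) := inferInstanceAs (Field Laurent)

instance (q : ℕ+) : Algebra ℂ (Ram q) := inferInstanceAs (Algebra ℂ Laurent)

/-- The substitution `f(x) ↦ f(y ^ q)`. -/
def ramify (q : ℕ+) : Laurent →ₐ[ℂ] Ram q :=
  HahnSeries.embDomainAlgHom (Γ := ℤ) (Γ' := ℤ) (R := ℂ) (A := ℂ)
    (AddMonoidHom.mulLeft ((q : ℕ) : ℤ))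
    (mul_right_injective₀ (by exact_mod_cast q.ne_zero))
    (fun _ _ => mul_le_mul_iff_right₀ (by exact_mod_cast q.pos))

instance (q : ℕ+) : Algebra ConvLaurent (Ram q) :=
  ((ramify q).comp ConvLaurent.val).toRingHom.toAlgebra

instance (q : ℕ+) : IsScalarTower ℂ ConvLaurent (Ram q) :=
  IsScalarTower.of_algebraMap_eq' ((ramify q).comp ConvLaurent.val).comp_algebraMap.symm

/-- The coordinate `y`. -/
def Ram.y (q : ℕ+) : Ram q := Laurent.x

/-- The subring `ℂ[[y]]` of `ℂ((y))`. -/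
def formalIntegers (q : ℕ+) : Subalgebra ℂ (Ram q) := ofPS.range

/-- The derivation `y d/dy` of `ℂ((y))`. -/
def Ram.euler (q : ℕ+) : Ram q →ₗ[ℂ] Ram q := Laurent.euler

theorem Ram.euler_mul (q : ℕ+) (f g : Ram q) :
    Ram.euler q (f * g) = Ram.euler q f * g + f * Ram.euler q g :=
  Laurent.euler_mul f g

theorem euler_ramify (q : ℕ+) (f : Laurent) :
    Ram.euler q (ramify q f) = (q : ℕ) • ramify q f.euler := by
  have hq : (q : ℕ) • ramify q f.euler = ((q : ℕ) : ℂ) • ramify q f.euler := by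
    rw [Nat.cast_smul_eq_nsmul]
  rw [hq]
  refine Laurent.ext fun n => ?_
  refine (Laurent.coeff_euler _ n).trans ?_
  change (n : ℂ) * Laurent.coeff (ramify q f) n =
    ((q : ℕ) : ℂ) * Laurent.coeff (ramify q f.euler) n
  by_cases hn : ∃ m : ℤ, n = (q : ℕ) * m
  · obtain ⟨m, rfl⟩ := hn
    have key : ∀ h : Laurent, Laurent.coeff (ramify q h) ((q : ℕ) * m) = h.coeff m := fun h =>
      HahnSeries.embDomain_coeff (a := m)
    rw [key, key, Laurent.coeff_euler]
    push_cast
    ring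
  · have key : ∀ h : Laurent, Laurent.coeff (ramify q h) n = 0 := fun h =>
      HahnSeries.embDomain_of_notMem_range (by
        rintro ⟨m, hm⟩
        exact hn ⟨m, hm.symm⟩)
    rw [key, key, mul_zero, mul_zero]

/-- The polar parts: elements of `y⁻¹ℂ[y⁻¹]`. -/
def IsPolar {q : ℕ+} (φ : Ram q) : Prop := ∀ n : ℤ, 0 ≤ n → Laurent.coeff φ n = 0

/-! ### Modules generated by differential operators, and the Deligne filtration

In this section `F` is `ℂ{x}[1/x]` or `ℂ((y))`, `A ⊆ F` is its subring `ℂ{x}` or `ℂ[[y]]`, `t` is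
the coordinate, and `θ` is the action of `t∂_t` on an `F`-vector space `E` with connection. -/

section Generic

variable {F : Type*} [CommRing F] [Algebra ℂ F] (A : Subalgebra ℂ F)
  {E : Type*} [AddCommGroup E] [Module ℂ E] [Module F E]

/-- The algebra of operators on `E` generated by the multiplications by elements of `A` and by
the operator `D`. For `D = ∂_t` (resp. `t∂_t`) this is the image of `A⟨∂_t⟩` (resp. `A⟨t∂_t⟩`)
in `End_ℂ(E)`. -/
def operators (D : Module.End ℂ E) : Subalgebra ℂ (Module.End ℂ E) :=
  Algebra.adjoin ℂ ({T | ∃ a ∈ A, ∀ m, T m = a • m} ∪ {D})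

/-- `A⟨D⟩ · S`: the left `A⟨D⟩`-submodule of `E` generated by `S`. -/
def generated (D : Module.End ℂ E) (S : Set E) : Submodule ℂ E :=
  (Submodule.span (operators A D) S).restrictScalars ℂ

/-- `V^{>b} = ⋃_{b' > b} V^{b'}` for a decreasing filtration `V`. -/
def above (V : ℝ → Submodule ℂ E) (b : ℝ) : Submodule ℂ E :=
  ⨆ b' : Set.Ioi b, V b'

/-- `V` is a Deligne filtration of `E`: an exhaustive decreasing filtration indexed by `ℝ`, with a
discrete set of jumps, by finitely generated `A⟨t∂_t⟩`-submodules, such that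
`t V^b = V^{b+1}` and such that `gr^b_V = V^b / V^{>b}` is a finite dimensional vector space on
which the eigenvalues of `t∂_t` all have real part `b`. -/
structure IsDeligneFiltration (t : F) (θ : Module.End ℂ E) (V : ℝ → Submodule ℂ E) : Prop where
  antitone : Antitone V
  exhaustive : ∀ m, ∃ b, m ∈ V b
  finite_type : ∀ b, ∃ S : Finset E, V b = generated A θ S
  shift : ∀ b m, m ∈ V (b + 1) ↔ ∃ n ∈ V b, m = t • n
  /-- Off a finite union of classes `a + ℤ` the filtration does not jump: `V^b = V^c` as soon as
  no point `a + k` lies in `[b, c[`. -/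
  discrete : ∃ J : Finset ℝ, ∀ b c, b ≤ c →
    (∀ a ∈ J, ∀ k : ℤ, a + k ∉ Set.Ico b c) → V b = V c
  finite_dim : ∀ b, Module.Finite ℂ (V b ⧸ (above V b).submoduleOf (V b))
  /-- If the class of `m` in `gr^b_V` is a nonzero eigenvector of `t∂_t` for `β`,
  then `Re β = b`. -/
  eigenvalue : ∀ b, ∀ m ∈ V b, m ∉ above V b →
    ∀ β : ℂ, θ m - β • m ∈ above V b → β.re = b

/-- The Deligne filtration `V^b E`. A filtration as in `IsDeligneFiltration` is unique, so that
the supremum over all of them is the filtration itself. -/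
def deligne (t : F) (θ : Module.End ℂ E) (b : ℝ) : Submodule ℂ E :=
  ⨆ (V : ℝ → Submodule ℂ E) (_ : IsDeligneFiltration A t θ V), V b

/-- The singularity of the connection is regular: there is a lattice (a finitely generated
`A`-submodule that generates `E` over `F`) that is stable under `t∂_t`. -/
def IsRegularSingular (θ : Module.End ℂ E) : Prop :=
  ∃ L : Submodule A E, L.FG ∧ Submodule.span F (L : Set E) = ⊤ ∧ ∀ m ∈ L, θ m ∈ L

end Generic

/-! ### Germs of meromorphic connections -/

/-- A connection on a `ℂ{x}[1/x]`-vector space `M`, given by the action of `∂_x`. -/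
structure Connection (M : Type*) [AddCommGroup M] [Module ℂ M] [Module ConvLaurent M] where
  /-- The action of `∂_x`. -/
  d : Module.End ℂ M
  leibniz : ∀ (f : ConvLaurent) (m : M), d (f • m) = ConvLaurent.deriv f • m + f • d m

namespace Connection

variable {M : Type*} [AddCommGroup M] [Module ℂ M] [Module ConvLaurent M]
  [IsScalarTower ℂ ConvLaurent M] (C : Connection M)

/-- The action of `x∂_x` on `M`. -/
def euler : Module.End ℂ M where
  toFun m := ConvLaurent.x • C.d m
  map_add' m n := by rw [map_add, smul_add]
  map_smul' c m := by rw [map_smul, smul_comm, RingHom.id_apply]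

/-- The Deligne filtration `V^b M`. -/
def V (b : ℝ) : Submodule ℂ M := deligne convIntegers ConvLaurent.x C.euler b

/-- `ℂ{x}⟨∂_x⟩ · S` for a subset `S` of `M`. -/
def DSpan (S : Set M) : Submodule ℂ M := generated convIntegers C.d S

/-- The minimal extension `ℂ{x}⟨∂_x⟩ · V^{>-1} M`. -/
def minimalExtension : Submodule ℂ M := C.DSpan (above C.V (-1))

/-- The action of `y∂_y` on the formalized pull-back `ℂ((y)) ⊗ M` by `x = y ^ q`:
`g ⊗ m ↦ (y dg/dy) ⊗ m + g ⊗ q (x∂_x m)`. -/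
def pullbackEuler (q : ℕ+) : Module.End ℂ (Ram q ⊗[ConvLaurent] M) :=
  let B : Ram q →+ M →+ Ram q ⊗[ConvLaurent] M :=
    AddMonoidHom.mk' (fun g => AddMonoidHom.mk'
      (fun m => Ram.euler q g ⊗ₜ m + g ⊗ₜ ((q : ℕ) • C.euler m))
      (fun m n => by rw [map_add, smul_add, TensorProduct.tmul_add, TensorProduct.tmul_add]; abel))
      (fun g h => by
        ext m
        simp only [AddMonoidHom.mk'_apply, AddMonoidHom.add_apply, map_add, TensorProduct.add_tmul]
        abel)
  let T : Ram q ⊗[ConvLaurent] M →+ Ram q ⊗[ConvLaurent] M :=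
    TensorProduct.liftAddHom B (by
      intro f g m
      have h1 : Ram.euler q (f • g) =
          ((q : ℕ) • (ConvLaurent.x * ConvLaurent.deriv f)) • g + f • Ram.euler q g := by
        rw [Algebra.smul_def, Ram.euler_mul, ← Algebra.smul_def, Algebra.smul_def]
        congr 2
        rw [map_nsmul]
        exact euler_ramify q f
      have h2 : C.euler (f • m) = (ConvLaurent.x * ConvLaurent.deriv f) • m + f • C.euler m := by
        change ConvLaurent.x • C.d (f • m) = _ + f • (ConvLaurent.x • C.d m)
        rw [C.leibniz, smul_add, mul_smul, smul_comm ConvLaurent.x f]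
      change Ram.euler q (f • g) ⊗ₜ[ConvLaurent] m + (f • g) ⊗ₜ[ConvLaurent] ((q : ℕ) • C.euler m)
        = Ram.euler q g ⊗ₜ[ConvLaurent] (f • m) + g ⊗ₜ[ConvLaurent] ((q : ℕ) • C.euler (f • m))
      rw [h1, h2, TensorProduct.add_tmul, smul_add, TensorProduct.tmul_add, ← smul_assoc,
        smul_comm (q : ℕ) f, ← TensorProduct.smul_tmul f g,
        ← TensorProduct.smul_tmul _ g, TensorProduct.smul_tmul f (Ram.euler q g)]
      abel)
  { T with
    map_smul' := fun c n => by
      change T (c • n) = c • T n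
      induction n using TensorProduct.induction_on with
      | zero => simp
      | tmul g m =>
        rw [TensorProduct.smul_tmul']
        change Ram.euler q (c • g) ⊗ₜ[ConvLaurent] m + (c • g) ⊗ₜ[ConvLaurent] _ =
          c • (Ram.euler q g ⊗ₜ[ConvLaurent] m + g ⊗ₜ[ConvLaurent] _)
        rw [map_smul, smul_add, TensorProduct.smul_tmul', TensorProduct.smul_tmul']
      | add a b ha hb => rw [smul_add, map_add, ha, hb, map_add, smul_add] }

theorem pullbackEuler_tmul (q : ℕ+) (g : Ram q) (m : M) :
    C.pullbackEuler q (g ⊗ₜ m) = Ram.euler q g ⊗ₜ m + g ⊗ₜ ((q : ℕ) • C.euler m) :=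
  rfl

/-- The operator `y∂_y - yφ'` on a subspace `W` of `ℂ((y)) ⊗ M` stable by the connection. -/
def twistedEuler {q : ℕ+} (W : Submodule (Ram q) (Ram q ⊗[ConvLaurent] M))
    (hW : ∀ n ∈ W, C.pullbackEuler q n ∈ W) (φ : Ram q) : Module.End ℂ W where
  toFun n := ⟨C.pullbackEuler q n - Ram.euler q φ • (n : Ram q ⊗[ConvLaurent] M),
    sub_mem (hW _ n.2) (W.smul_mem _ n.2)⟩
  map_add' m n := by
    ext
    simp only [Submodule.coe_add, map_add, smul_add]
    abel
  map_smul' c n := by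
    ext
    change C.pullbackEuler q (c • (n : Ram q ⊗[ConvLaurent] M)) -
      Ram.euler q φ • c • (n : Ram q ⊗[ConvLaurent] M) = c • (_ - _)
    rw [map_smul, smul_comm _ c, smul_sub]

/-- An elementary formal model of the pull-back of `M` by `x = y ^ q`: a decomposition of
`ℂ((y)) ⊗ M` into a direct sum, indexed by a finite set `Φ` of `φ ∈ y⁻¹ℂ[y⁻¹]`, of subspaces
stable by the connection and isomorphic to `E^φ ⊗ R_φ` with `R_φ` regular. Since
`E^φ = (ℂ((y)), d + dφ)`, the space `E^φ ⊗ R_φ` is the vector space `R_φ` on which `y∂_y` is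
replaced by `y∂_y + yφ'`. Thus `R_φ` is the `φ`-summand with the operator `y∂_y - yφ'`. -/
structure ElementaryModel (q : ℕ+) where
  /-- The exponential factors. -/
  Φ : Finset (Ram q)
  polar : ∀ φ ∈ Φ, IsPolar φ
  /-- The summand `E^φ ⊗ R_φ`. -/
  summand : Φ → Submodule (Ram q) (Ram q ⊗[ConvLaurent] M)
  independent : iSupIndep summand
  iSup_eq_top : ⨆ φ, summand φ = ⊤
  stable : ∀ φ, ∀ n ∈ summand φ, C.pullbackEuler q n ∈ summand φ
  regular : ∀ φ : Φ, IsRegularSingular (E := summand φ) (formalIntegers q)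
    (C.twistedEuler (summand φ) (stable φ) φ)

namespace ElementaryModel

variable {C} {q : ℕ+} (S : C.ElementaryModel q)

/-- The Deligne filtration `V^b R_φ`. -/
def regularV (φ : S.Φ) (b : ℝ) : Submodule ℂ (S.summand φ) :=
  deligne (E := S.summand φ) (formalIntegers q) (Ram.y q)
    (C.twistedEuler (S.summand φ) (S.stable φ) φ) b

/-- The filtration `P^b = ⨁_φ (E^φ ⊗ V^b R_φ)` of `ℂ((y)) ⊗ M`. -/
def formalParabolic (b : ℝ) : Submodule ℂ (Ram q ⊗[ConvLaurent] M) :=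
  ⨆ φ, (S.regularV φ b).map ((S.summand φ).subtype.restrictScalars ℂ)

/-- The canonical parabolic filtration of `M`: `P^b M` is the set of the `m ∈ M` such that `1 ⊗ m`
lies in `P^{qb}(ℂ((y)) ⊗ M)`. Here `M` is identified, by `m ↦ 1 ⊗ m`, with the space of
`ℤ/qℤ`-invariants of its pull-back by `x = y ^ q`. -/
def parabolic (b : ℝ) : Submodule ℂ M :=
  (S.formalParabolic (q * b)).comap
    ((TensorProduct.mk ConvLaurent (Ram q) M 1).restrictScalars ℂ)

end ElementaryModel

end Connection

end MeroConn

end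

noncomputable section

set_option linter.unusedSectionVars false

namespace MeroConn

section Generic

variable {F : Type*} [CommRing F] [Algebra ℂ F] {A : Subalgebra ℂ F}
  {E : Type*} [AddCommGroup E] [Module ℂ E] [Module F E]

/-! ### Modules generated by operators -/

theorem subset_generated (D : Module.End ℂ E) (S : Set E) : S ⊆ generated A D S :=
  fun _ h => Submodule.subset_span h

theorem smul_mem_generated [SMulCommClass F ℂ E] {D : Module.End ℂ E} {S : Set E} {a : F}
    (ha : a ∈ A) {m : E} (hm : m ∈ generated A D S) : a • m ∈ generated A D S := by
  let T : Module.End ℂ E :=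
    { toFun := fun m => a • m
      map_add' := smul_add a
      map_smul' := fun c m => smul_comm a c m }
  have hT : T ∈ operators A D := Algebra.subset_adjoin (Or.inl ⟨a, ha, fun _ => rfl⟩)
  exact Submodule.smul_mem (Submodule.span (operators A D) S) ⟨T, hT⟩ hm

theorem apply_mem_generated {D : Module.End ℂ E} {S : Set E} {m : E}
    (hm : m ∈ generated A D S) : D m ∈ generated A D S := by
  have hD : D ∈ operators A D := Algebra.subset_adjoin (Or.inr rfl)
  exact Submodule.smul_mem (Submodule.span (operators A D) S) ⟨D, hD⟩ hm

theorem generated_le {D : Module.End ℂ E} {S : Set E} {W : Submodule ℂ E} (hS : S ⊆ W)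
    (hA : ∀ a ∈ A, ∀ m ∈ W, a • m ∈ W) (hD : ∀ m ∈ W, D m ∈ W) : generated A D S ≤ W := by
  intro m hm
  change m ∈ Submodule.span (operators A D) S at hm
  induction hm using Submodule.span_induction with
  | mem x h => exact hS h
  | zero => exact zero_mem _
  | add x y _ _ hx hy => exact add_mem hx hy
  | smul T x _ hx =>
    obtain ⟨T, hT⟩ := T
    change T x ∈ W
    revert x
    suffices ∀ x ∈ W, T x ∈ W from fun x _ hx => this x hx
    induction hT using Algebra.adjoin_induction with
    | mem T h =>
      intro x hx
      rcases h with ⟨a, ha, h⟩ | h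
      · rw [h]; exact hA a ha x hx
      · rw [Set.mem_singleton_iff.1 h]; exact hD x hx
    | algebraMap r => intro x hx; exact W.smul_mem r hx
    | add S T _ _ hS hT => intro x hx; exact add_mem (hS x hx) (hT x hx)
    | mul S T _ _ hS hT => intro x hx; exact hS _ (hT x hx)

theorem generated_mono {D : Module.End ℂ E} {S S' : Set E} (h : S ⊆ S') :
    generated A D S ≤ generated A D S' :=
  fun _ hm => Submodule.span_mono h hm

theorem mem_above {V : ℝ → Submodule ℂ E} (hV : Antitone V) {b : ℝ} {m : E} :
    m ∈ above V b ↔ ∃ c, b < c ∧ m ∈ V c := by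
  have : Nonempty (Set.Ioi b) := ⟨⟨b + 1, by simp⟩⟩
  have hd : Directed (· ≤ ·) fun c : Set.Ioi b => V c := fun c d =>
    ⟨⟨min c d, Set.mem_Ioi.2 (lt_min (Set.mem_Ioi.1 c.2) (Set.mem_Ioi.1 d.2))⟩,
      hV (min_le_left _ _), hV (min_le_right _ _)⟩
  rw [above, Submodule.mem_iSup_of_directed _ hd]
  simp

/-! ### Polynomials in an operator -/

theorem aeval_apply_mem {θ : Module.End ℂ E} {W : Submodule ℂ E} (hW : ∀ m ∈ W, θ m ∈ W)
    (Q : Polynomial ℂ) {m : E} (hm : m ∈ W) : Polynomial.aeval θ Q m ∈ W := by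
  induction Q using Polynomial.induction_on' with
  | add p q hp hq => rw [map_add]; exact add_mem hp hq
  | monomial n c =>
    rw [Polynomial.aeval_monomial, Module.algebraMap_end_eq_smul_id]
    refine W.smul_mem c ?_
    change (θ ^ n) m ∈ W
    induction n with
    | zero => exact hm
    | succ n ih => rw [pow_succ']; exact hW _ ih

theorem map_aeval_apply {E' : Type*} [AddCommGroup E'] [Module ℂ E'] {θ : Module.End ℂ E}
    {θ' : Module.End ℂ E'} (f : E →ₗ[ℂ] E') (h : ∀ m, f (θ m) = θ' (f m)) (Q : Polynomial ℂ)
    (m : E) : f (Polynomial.aeval θ Q m) = Polynomial.aeval θ' Q (f m) := by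
  induction Q using Polynomial.induction_on' with
  | add p q hp hq => simp [hp, hq]
  | monomial n c =>
    rw [Polynomial.aeval_monomial, Polynomial.aeval_monomial, Module.algebraMap_end_eq_smul_id,
      Module.algebraMap_end_eq_smul_id]
    change f (c • (θ ^ n) m) = c • (θ' ^ n) (f m)
    rw [map_smul]
    congr 1
    induction n with
    | zero => rfl
    | succ n ih => rw [pow_succ', pow_succ']; change f (θ _) = θ' _; rw [h, ih]

theorem exists_annihilating {θ : Module.End ℂ E} {V W : Submodule ℂ E} (hV : ∀ m ∈ V, θ m ∈ V)
    (hW : ∀ m ∈ W, θ m ∈ W) (hfin : Module.Finite ℂ (V ⧸ W.submoduleOf V)) :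
    ∃ Q : Polynomial ℂ, Q ≠ 0 ∧ (∀ m ∈ V, Polynomial.aeval θ Q m ∈ W) ∧
      ∀ β, Q.IsRoot β → ∃ m ∈ V, m ∉ W ∧ θ m - β • m ∈ W := by
  let θV : Module.End ℂ V := θ.restrict hV
  let θq : Module.End ℂ (V ⧸ W.submoduleOf V) :=
    (W.submoduleOf V).mapQ (W.submoduleOf V) θV fun m hm => hW _ hm
  have hint : IsIntegral ℂ θq := Algebra.IsIntegral.isIntegral θq
  refine ⟨minpoly ℂ θq, minpoly.ne_zero hint, fun m hm => ?_, fun β hβ => ?_⟩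
  · have h1 := map_aeval_apply (θ := θV) (θ' := θq) (W.submoduleOf V).mkQ (fun _ => rfl)
      (minpoly ℂ θq) ⟨m, hm⟩
    have h2 := map_aeval_apply (θ := θV) (θ' := θ) V.subtype (fun _ => rfl)
      (minpoly ℂ θq) ⟨m, hm⟩
    rw [minpoly.aeval] at h1
    have h3 := (Submodule.Quotient.mk_eq_zero _).1 h1
    change V.subtype _ ∈ W at h3
    rwa [h2] at h3
  · obtain ⟨v, hv⟩ := (Module.End.hasEigenvalue_of_isRoot hβ).exists_hasEigenvector
    obtain ⟨m, rfl⟩ := Submodule.Quotient.mk_surjective _ v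
    refine ⟨m, m.2, fun h => hv.2 ((Submodule.Quotient.mk_eq_zero _).2 h), ?_⟩
    have h1 := hv.apply_eq_smul
    change Submodule.Quotient.mk (θV m) = β • Submodule.Quotient.mk m at h1
    rw [← Submodule.Quotient.mk_smul, Submodule.Quotient.eq] at h1
    exact h1

theorem exists_gcd_aeval_mem {θ : Module.End ℂ E} {W : Submodule ℂ E} (hW : ∀ m ∈ W, θ m ∈ W)
    {P Q : Polynomial ℂ} (hP : P ≠ 0) {m : E} (h1 : Polynomial.aeval θ P m ∈ W)
    (h2 : Polynomial.aeval θ Q m ∈ W) :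
    ∃ G : Polynomial ℂ, G ≠ 0 ∧ (∀ β, G.IsRoot β → P.IsRoot β ∧ Q.IsRoot β) ∧
      Polynomial.aeval θ G m ∈ W := by
  refine ⟨EuclideanDomain.gcd P Q, fun h => hP (EuclideanDomain.gcd_eq_zero_iff.1 h).1,
    fun β hβ => ⟨hβ.dvd (EuclideanDomain.gcd_dvd_left P Q),
      hβ.dvd (EuclideanDomain.gcd_dvd_right P Q)⟩, ?_⟩
  rw [EuclideanDomain.gcd_eq_gcd_ab, mul_comm P, mul_comm Q, map_add, map_mul, map_mul]
  exact add_mem (aeval_apply_mem hW _ h1) (aeval_apply_mem hW _ h2)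

/-! ### Uniqueness of the Deligne filtration -/

theorem jump_induction {V : ℝ → Submodule ℂ E} (hV : Antitone V) {J : Finset ℝ}
    (hJ : ∀ b c, b ≤ c → (∀ a ∈ J, ∀ k : ℤ, a + k ∉ Set.Ico b c) → V b = V c)
    (p : Submodule ℂ E → Prop) {c b : ℝ} (hcb : c ≤ b) (h0 : p (V c))
    (hstep : ∀ j, c ≤ j → j < b → p (V j) → p (above V j)) : p (V b) := by
  have hfin : ∀ c : ℝ, {x : ℝ | ∃ a ∈ J, ∃ k : ℤ, a + k = x ∧ c ≤ x ∧ x < b}.Finite := by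
    intro c
    refine Set.Finite.subset (J.finite_toSet.biUnion fun a _ =>
      (Set.finite_Icc ⌊c - a⌋ ⌈b - a⌉).image fun k : ℤ => a + k) ?_
    rintro x ⟨a, ha, k, rfl, h1, h2⟩
    refine Set.mem_biUnion ha ⟨k, ⟨?_, ?_⟩, rfl⟩
    · have := Int.floor_le (c - a)
      exact_mod_cast (by linarith : (⌊c - a⌋ : ℝ) ≤ k)
    · have := Int.le_ceil (b - a)
      exact_mod_cast (by linarith : (k : ℝ) ≤ ⌈b - a⌉)
  generalize hn : {x : ℝ | ∃ a ∈ J, ∃ k : ℤ, a + k = x ∧ c ≤ x ∧ x < b}.ncard = n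
  induction n using Nat.strong_induction_on generalizing c with
  | _ n ih =>
    rcases Set.eq_empty_or_nonempty
      {x : ℝ | ∃ a ∈ J, ∃ k : ℤ, a + k = x ∧ c ≤ x ∧ x < b} with he | hne
    · rwa [← hJ c b hcb]
      intro a ha k hk
      exact (Set.eq_empty_iff_forall_notMem.1 he) _ ⟨a, ha, k, rfl, hk.1, hk.2⟩
    · obtain ⟨j, ⟨a, ha, k, hj, hcj, hjb⟩, hmin⟩ := Set.exists_min_image _ id (hfin c) hne
      have hVj : V c = V j := hJ c j hcj fun a' ha' k' hk' =>
        absurd (hmin _ ⟨a', ha', k', rfl, hk'.1, hk'.2.trans hjb⟩) (not_le.2 hk'.2)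
      have hab := hstep j hcj hjb (hVj ▸ h0)
      have key : ∃ d, j < d ∧ d ≤ b ∧
          ∀ a ∈ J, ∀ k : ℤ, a + k ∉ Set.Ioo j d := by
        have hf : {x : ℝ | ∃ a ∈ J, ∃ k : ℤ, a + k = x ∧ j < x ∧ x < b}.Finite :=
          Set.Finite.subset (hfin j) fun x ⟨a, ha, k, h, h1, h2⟩ => ⟨a, ha, k, h, h1.le, h2⟩
        rcases Set.eq_empty_or_nonempty
          {x : ℝ | ∃ a ∈ J, ∃ k : ℤ, a + k = x ∧ j < x ∧ x < b} with he | hne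
        · exact ⟨b, hjb, le_rfl, fun a ha k hk =>
            (Set.eq_empty_iff_forall_notMem.1 he) _ ⟨a, ha, k, rfl, hk.1, hk.2⟩⟩
        · obtain ⟨d, ⟨_, _, _, _, hjd, hdb⟩, hmin'⟩ := Set.exists_min_image _ id hf hne
          exact ⟨d, hjd, hdb.le, fun a' ha' k' hk' =>
            absurd (hmin' _ ⟨a', ha', k', rfl, hk'.1, hk'.2.trans hdb⟩) (not_le.2 hk'.2)⟩
      obtain ⟨d, hjd, hdb, hd⟩ := key
      have hVd : above V j = V d := by
        refine le_antisymm (iSup_le fun e => ?_) (le_iSup_of_le (⟨d, hjd⟩ : Set.Ioi j) le_rfl)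
        rcases le_total d e with h | h
        · exact hV h
        · exact (hJ e d h fun a ha k hk =>
            hd a ha k ⟨lt_of_lt_of_le (Set.mem_Ioi.1 e.2) hk.1, hk.2⟩).le
      rw [hVd] at hab
      refine ih _ ?_ hdb hab (fun i hi => hstep i ((hcj.trans hjd.le).trans hi)) rfl
      rw [← hn]
      refine Set.ncard_lt_ncard ⟨fun x ⟨a, ha, k, h, h1, h2⟩ =>
        ⟨a, ha, k, h, (hcj.trans hjd.le).trans h1, h2⟩, fun h => ?_⟩ (hfin c)
      obtain ⟨_, _, _, _, h, _⟩ := h ⟨a, ha, k, hj, hcj, hjb⟩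
      exact absurd h (not_le.2 hjd)

namespace IsDeligneFiltration

variable {t : F} {θ : Module.End ℂ E} {V V' : ℝ → Submodule ℂ E}

theorem apply_mem (h : IsDeligneFiltration A t θ V) {b : ℝ} {m : E} (hm : m ∈ V b) :
    θ m ∈ V b := by
  obtain ⟨S, hS⟩ := h.finite_type b
  rw [hS] at hm ⊢
  exact apply_mem_generated hm

theorem smul_mem [SMulCommClass F ℂ E] (h : IsDeligneFiltration A t θ V) {b : ℝ} {a : F}
    (ha : a ∈ A) {m : E} (hm : m ∈ V b) : a • m ∈ V b := by
  obtain ⟨S, hS⟩ := h.finite_type b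
  rw [hS] at hm ⊢
  exact smul_mem_generated ha hm

theorem apply_mem_above (h : IsDeligneFiltration A t θ V) {b : ℝ} {m : E} (hm : m ∈ above V b) :
    θ m ∈ above V b := by
  rw [mem_above h.antitone] at hm ⊢
  obtain ⟨c, hc, hm⟩ := hm
  exact ⟨c, hc, h.apply_mem hm⟩

theorem mem_of_aeval_mem (h : IsDeligneFiltration A t θ V) {b : ℝ} {Q : Polynomial ℂ}
    (hQ : Q ≠ 0) (hroots : ∀ β, Q.IsRoot β → b ≤ β.re) {m : E}
    (hm : Polynomial.aeval θ Q m ∈ V b) : m ∈ V b := by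
  have key : ∀ (β : ℂ) (m : E), b ≤ β.re → θ m - β • m ∈ V b → m ∈ V b := by
    intro β m hβ hm
    obtain ⟨c, hc⟩ := h.exhaustive m
    obtain ⟨J, hJ⟩ := h.discrete
    rcases le_total b c with hbc | hcb
    · exact h.antitone hbc hc
    refine jump_induction h.antitone hJ (fun W => m ∈ W) hcb hc fun j _ hjb hj => ?_
    by_contra hn
    have := h.eigenvalue j m hj hn β ((mem_above h.antitone).2 ⟨b, hjb, hm⟩)
    linarith
  generalize hn : Q.natDegree = n
  induction n generalizing Q m with
  | zero =>
    rw [Polynomial.eq_C_of_natDegree_eq_zero hn, Polynomial.aeval_C,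
      Module.algebraMap_end_apply] at hm
    refine ((V b).smul_mem_iff ?_).1 hm
    intro h0
    exact hQ (by rw [Polynomial.eq_C_of_natDegree_eq_zero hn, h0, map_zero])
  | succ n ih =>
    obtain ⟨β, hβ⟩ := IsAlgClosed.exists_root Q (by
      intro h0
      have := Polynomial.natDegree_eq_of_degree_eq_some (n := 0) h0
      omega)
    obtain ⟨R, rfl⟩ := Polynomial.dvd_iff_isRoot.2 hβ
    have hR : R ≠ 0 := right_ne_zero_of_mul hQ
    refine ih hR (fun γ hγ => hroots γ (hγ.dvd (dvd_mul_left _ _))) ?_ ?_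
    · refine key β _ (hroots β hβ) ?_
      rw [map_mul] at hm
      simpa [sub_smul] using hm
    · rw [Polynomial.natDegree_mul (Polynomial.X_sub_C_ne_zero β) hR,
        Polynomial.natDegree_X_sub_C] at hn
      omega

theorem exists_aeval_mem (h : IsDeligneFiltration A t θ V) (b c : ℝ) :
    ∃ Q : Polynomial ℂ, Q ≠ 0 ∧ (∀ β, Q.IsRoot β → b ≤ β.re) ∧
      ∀ m ∈ V b, Polynomial.aeval θ Q m ∈ V c := by
  rcases le_total c b with hcb | hbc
  · exact ⟨1, one_ne_zero, fun β hβ => by simp [Polynomial.IsRoot] at hβ,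
      fun m hm => by simpa using h.antitone hcb hm⟩
  obtain ⟨J, hJ⟩ := h.discrete
  refine jump_induction h.antitone hJ (fun W => ∃ Q : Polynomial ℂ, Q ≠ 0 ∧
    (∀ β, Q.IsRoot β → b ≤ β.re) ∧ ∀ m ∈ V b, Polynomial.aeval θ Q m ∈ W) hbc
    ⟨1, one_ne_zero, fun β hβ => by simp [Polynomial.IsRoot] at hβ, fun m hm => by simpa using hm⟩
    fun j hbj _ => ?_
  rintro ⟨Q, hQ, hroots, hm⟩
  obtain ⟨R, hR, hRm, hRroots⟩ := exists_annihilating (θ := θ) (V := V j) (W := above V j)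
    (fun _ => h.apply_mem) (fun _ => h.apply_mem_above) (h.finite_dim j)
  refine ⟨R * Q, mul_ne_zero hR hQ, fun β hβ => ?_, fun m hmb => ?_⟩
  · rcases Polynomial.root_mul.1 hβ with hβ | hβ
    · obtain ⟨m, h1, h2, h3⟩ := hRroots β hβ
      exact hbj.trans (h.eigenvalue j m h1 h2 β h3).ge
    · exact hroots β hβ
  · rw [map_mul]
    exact hRm _ (hm m hmb)

theorem mem_add_natCast (h : IsDeligneFiltration A t θ V) (b : ℝ) (k : ℕ) {m : E} :
    m ∈ V (b + k) ↔ ∃ n ∈ V b, m = t ^ k • n := by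
  induction k generalizing m with
  | zero => simp
  | succ k ih =>
    rw [Nat.cast_succ, ← add_assoc, h.shift]
    constructor
    · rintro ⟨n, hn, rfl⟩
      obtain ⟨n, hn', rfl⟩ := ih.1 hn
      exact ⟨n, hn', by rw [pow_succ', mul_smul]⟩
    · rintro ⟨n, hn, rfl⟩
      exact ⟨t ^ k • n, ih.2 ⟨n, hn, rfl⟩, by rw [pow_succ', mul_smul]⟩

protected theorem le [SMulCommClass F ℂ E] (h : IsDeligneFiltration A t θ V)
    (h' : IsDeligneFiltration A t θ V') (b : ℝ) : V b ≤ V' b := by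
  obtain ⟨S, hS⟩ := h.finite_type b
  have h1 : ∃ c, V b ≤ V' c := by
    choose f hf using h'.exhaustive
    obtain ⟨c, hc⟩ := (S.image f).bddBelow
    refine ⟨c, hS ▸ generated_le (fun m hm => ?_) (fun a ha m => h'.smul_mem ha)
      (fun m => h'.apply_mem)⟩
    exact h'.antitone (hc (Finset.mem_coe.2 (Finset.mem_image_of_mem f hm))) (hf m)
  obtain ⟨c, hc⟩ := h1
  obtain ⟨k, hk⟩ := exists_nat_ge (b - c)
  obtain ⟨Q, hQ, hroots, hm⟩ := h.exists_aeval_mem b (b + k)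
  intro m hmb
  refine h'.mem_of_aeval_mem hQ hroots (h'.antitone (by linarith : b ≤ c + k) ?_)
  obtain ⟨n, hn, e⟩ := (h.mem_add_natCast b k).1 (hm m hmb)
  exact (h'.mem_add_natCast c k).2 ⟨n, hc hn, e⟩

theorem deligne_eq [SMulCommClass F ℂ E] (h : IsDeligneFiltration A t θ V) :
    deligne A t θ = V := by
  funext b
  exact le_antisymm (iSup₂_le fun _ h' => h'.le h b) (le_iSup₂_of_le V h le_rfl)

end IsDeligneFiltration

end Generic

section Existence

/-! ### Existence of the Deligne filtration of a regular connection -/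

variable {F : Type*} [Field F] [Algebra ℂ F] {A : Subalgebra ℂ F}
  {E : Type*} [AddCommGroup E] [Module ℂ E] [Module F E] [IsScalarTower ℂ F E]

/-- The lattice `t ^ k L`. -/
def zpowLattice (t : F) (L : Submodule A E) (k : ℤ) : Submodule ℂ E where
  carrier := {m | t ^ (-k) • m ∈ L}
  add_mem' := fun h h' => by
    simp only [Set.mem_ofPred_eq, smul_add] at *
    exact add_mem h h'
  zero_mem' := by simp
  smul_mem' := fun c m h => by
    simp only [Set.mem_ofPred_eq] at *
    rw [smul_comm, ← algebraMap_smul A c]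
    exact L.smul_mem _ h

theorem mem_zpowLattice {t : F} {L : Submodule A E} {k : ℤ} {m : E} :
    m ∈ zpowLattice t L k ↔ t ^ (-k) • m ∈ L := Iff.rfl

theorem zpow_smul_mem_zpowLattice {t : F} (ht : t ≠ 0) {L : Submodule A E} {k l : ℤ} {m : E} :
    t ^ l • m ∈ zpowLattice t L k ↔ m ∈ zpowLattice t L (k - l) := by
  rw [mem_zpowLattice, mem_zpowLattice, smul_smul, ← zpow_add₀ ht]
  congr! 3
  ring

theorem zpowLattice_anti {t : F} (ht : t ≠ 0) (htA : t ∈ A) (L : Submodule A E) {k l : ℤ}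
    (h : k ≤ l) : zpowLattice t L l ≤ zpowLattice t L k := by
  obtain ⟨n, rfl⟩ := Int.le.dest h
  intro m hm
  rw [mem_zpowLattice] at hm ⊢
  have : t ^ (-k) • m = (⟨t ^ n, pow_mem htA n⟩ : A) • t ^ (-(k + n)) • m := by
    change _ = t ^ n • t ^ (-(k + n)) • m
    rw [smul_smul, ← zpow_natCast, ← zpow_add₀ ht]
    congr 2
    ring
  rw [this]
  exact L.smul_mem _ hm

theorem smul_mem_zpowLattice {t : F} {L : Submodule A E} {k : ℤ} {a : F} (ha : a ∈ A) {m : E}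
    (hm : m ∈ zpowLattice t L k) : a • m ∈ zpowLattice t L k := by
  rw [mem_zpowLattice] at hm ⊢
  rw [smul_comm]
  exact L.smul_mem ⟨a, ha⟩ hm

theorem euler_zpow_smul {t : F} (ht : t ≠ 0) {θ : Module.End ℂ E}
    (hθ : ∀ m, θ (t • m) = t • m + t • θ m) (k : ℤ) (m : E) :
    θ (t ^ k • m) = t ^ k • (θ m + (k : ℂ) • m) := by
  have hnat : ∀ (k : ℕ) (m : E), θ (t ^ k • m) = t ^ k • (θ m + (k : ℂ) • m) := by
    intro k
    induction k with
    | zero => simp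
    | succ k ih =>
      intro m
      rw [pow_succ, mul_smul, ih, hθ, mul_smul, smul_comm (k : ℂ) t m, ← smul_add t, ← smul_add t,
        Nat.cast_succ, add_smul, one_smul]
      congr 2
      abel
  obtain ⟨n, rfl | rfl⟩ := k.eq_nat_or_neg
  · simpa using hnat n m
  · have h1 := hnat n (t ^ (-(n : ℤ)) • m)
    have h2 : t ^ n • t ^ (-(n : ℤ)) • m = m := by
      rw [smul_smul, ← zpow_natCast, ← zpow_add₀ ht]
      simp
    rw [h2, smul_add, smul_comm (t ^ n) (n : ℂ), h2] at h1
    have h3 : t ^ (-(n : ℤ)) • t ^ n • θ (t ^ (-(n : ℤ)) • m) = θ (t ^ (-(n : ℤ)) • m) := by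
      rw [smul_smul, ← zpow_natCast, ← zpow_add₀ ht]
      simp
    rw [← h3, h1]
    simp

theorem aeval_zpow_smul {t : F} (ht : t ≠ 0) {θ : Module.End ℂ E}
    (hθ : ∀ m, θ (t • m) = t • m + t • θ m) (k : ℤ) (Q : Polynomial ℂ) (m : E) :
    Polynomial.aeval θ Q (t ^ k • m) =
      t ^ k • Polynomial.aeval θ (Q.comp (Polynomial.X + Polynomial.C (k : ℂ))) m := by
  let T : E →ₗ[ℂ] E :=
    { toFun := fun m => t ^ k • m
      map_add' := smul_add _
      map_smul' := fun c m => smul_comm _ c m }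
  have h := map_aeval_apply (θ := Polynomial.aeval θ (Polynomial.X + Polynomial.C (k : ℂ)))
    (θ' := θ) T (fun m => by
      change t ^ k • _ = θ (t ^ k • m)
      rw [euler_zpow_smul ht hθ]
      simp [Int.cast_smul_eq_zsmul ℂ]) Q m
  rw [← Polynomial.aeval_comp] at h
  exact h.symm

theorem isRoot_comp_X_add_C {Q : Polynomial ℂ} {k β : ℂ} :
    (Q.comp (Polynomial.X + Polynomial.C k)).IsRoot β ↔ Q.IsRoot (β + k) := by
  simp [Polynomial.IsRoot, Polynomial.eval_comp]

theorem comp_X_add_C_ne_zero {Q : Polynomial ℂ} (hQ : Q ≠ 0) (k : ℂ) :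
    Q.comp (Polynomial.X + Polynomial.C k) ≠ 0 := by
  intro h
  rw [Polynomial.comp_X_add_C_eq_zero_iff] at h
  exact hQ h

theorem apply_mem_zpowLattice {t : F} (ht : t ≠ 0) {θ : Module.End ℂ E}
    (hθ : ∀ m, θ (t • m) = t • m + t • θ m) {L : Submodule A E} (hL : ∀ m ∈ L, θ m ∈ L) {k : ℤ}
    {m : E} (hm : m ∈ zpowLattice t L k) : θ m ∈ zpowLattice t L k := by
  rw [mem_zpowLattice] at *
  have h := euler_zpow_smul ht hθ (-k) m
  rw [smul_add, smul_comm _ ((-k : ℤ) : ℂ) m] at h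
  rw [← sub_eq_iff_eq_add.2 h, ← algebraMap_smul A ((-k : ℤ) : ℂ)]
  exact sub_mem (hL _ hm) (L.smul_mem _ hm)

/-- The elements that, modulo every lattice `t ^ k L`, are killed by a polynomial in `θ` whose
roots have real part at least `b`. -/
def spectralFiltration (t : F) (ht : t ≠ 0) (θ : Module.End ℂ E)
    (hθ : ∀ m, θ (t • m) = t • m + t • θ m) (L : Submodule A E) (hL : ∀ m ∈ L, θ m ∈ L) (b : ℝ) :
    Submodule ℂ E where
  carrier := {m | ∀ k : ℤ, ∃ Q : Polynomial ℂ, Q ≠ 0 ∧ (∀ β, Q.IsRoot β → b ≤ β.re) ∧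
    Polynomial.aeval θ Q m ∈ zpowLattice t L k}
  add_mem' := fun {m n} hm hn k => by
    obtain ⟨Q, hQ, hQr, hm⟩ := hm k
    obtain ⟨R, hR, hRr, hn⟩ := hn k
    refine ⟨Q * R, mul_ne_zero hQ hR, fun β hβ => ?_, ?_⟩
    · rcases Polynomial.root_mul.1 hβ with h | h
      exacts [hQr β h, hRr β h]
    · rw [map_add]
      refine add_mem ?_ ?_
      · rw [mul_comm, map_mul]
        exact aeval_apply_mem (fun _ => apply_mem_zpowLattice ht hθ hL) _ hm
      · rw [map_mul]
        exact aeval_apply_mem (fun _ => apply_mem_zpowLattice ht hθ hL) _ hn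
  zero_mem' := fun k => ⟨1, one_ne_zero, fun β hβ => by simp [Polynomial.IsRoot] at hβ, by simp⟩
  smul_mem' := fun c m hm k => by
    obtain ⟨Q, hQ, hQr, hm⟩ := hm k
    exact ⟨Q, hQ, hQr, by rw [map_smul]; exact Submodule.smul_mem _ c hm⟩

variable {t : F} {ht : t ≠ 0} {θ : Module.End ℂ E} {hθ : ∀ m, θ (t • m) = t • m + t • θ m}
  {L : Submodule A E} {hL : ∀ m ∈ L, θ m ∈ L}

theorem spectralFiltration_antitone : Antitone (spectralFiltration t ht θ hθ L hL) := by
  intro b c hbc m hm k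
  obtain ⟨Q, hQ, hQr, hm⟩ := hm k
  exact ⟨Q, hQ, fun β hβ => hbc.trans (hQr β hβ), hm⟩

theorem zpow_smul_mem_spectralFiltration {b : ℝ} (l : ℤ) {m : E} :
    t ^ l • m ∈ spectralFiltration t ht θ hθ L hL (b + l) ↔
      m ∈ spectralFiltration t ht θ hθ L hL b := by
  have key : ∀ (b : ℝ) (l : ℤ) (m : E), m ∈ spectralFiltration t ht θ hθ L hL b →
      t ^ l • m ∈ spectralFiltration t ht θ hθ L hL (b + l) := by
    intro b l m hm k
    obtain ⟨Q, hQ, hQr, hm⟩ := hm (k - l)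
    refine ⟨Q.comp (Polynomial.X + Polynomial.C ((-l : ℤ) : ℂ)), comp_X_add_C_ne_zero hQ _,
      fun β hβ => ?_, ?_⟩
    · have := hQr _ (isRoot_comp_X_add_C.1 hβ)
      simp at this
      linarith
    · rw [aeval_zpow_smul ht hθ, zpow_smul_mem_zpowLattice ht, Polynomial.comp_assoc]
      simpa using hm
  refine ⟨fun h => ?_, key b l m⟩
  have := key _ (-l) _ h
  rwa [smul_smul, ← zpow_add₀ ht, neg_add_cancel, zpow_zero, one_smul, Int.cast_neg,
    add_neg_cancel_right] at this

theorem smul_mem_spectralFiltration (htA : t ∈ A)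
    (hA : ∀ a ∈ A, ∃ c : ℂ, ∃ a' ∈ A, a = algebraMap ℂ F c + t * a')
    (hLt : ∀ m : E, ∃ k : ℤ, m ∈ zpowLattice t L k)
    {b : ℝ} {a : F} (ha : a ∈ A) {m : E} (hm : m ∈ spectralFiltration t ht θ hθ L hL b) :
    a • m ∈ spectralFiltration t ht θ hθ L hL b := by
  intro k
  obtain ⟨s, hs⟩ := hLt m
  have key : ∀ (n : ℕ) (s : ℤ), k ≤ s + n → ∀ a ∈ A, ∀ m : E, m ∈ zpowLattice t L s →
      m ∈ spectralFiltration t ht θ hθ L hL b →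
      ∃ Q : Polynomial ℂ, Q ≠ 0 ∧ (∀ β, Q.IsRoot β → b ≤ β.re) ∧
      Polynomial.aeval θ Q (a • m) ∈ zpowLattice t L k := by
    intro n
    induction n with
    | zero =>
      intro s hk a ha m hm _
      refine ⟨1, one_ne_zero, fun β hβ => by simp [Polynomial.IsRoot] at hβ, ?_⟩
      rw [map_one]
      exact zpowLattice_anti ht htA L (by simpa using hk) (smul_mem_zpowLattice ha hm)
    | succ n ih =>
      intro s hk a ha m hm hmb
      obtain ⟨c, a', ha', rfl⟩ := hA a ha
      have h1 : t • m ∈ zpowLattice t L (s + 1) := by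
        have := (zpow_smul_mem_zpowLattice ht (L := L) (k := s + 1) (l := 1) (m := m)).2
          (by simpa using hm)
        simpa using this
      have h2 : t • m ∈ spectralFiltration t ht θ hθ L hL b := by
        refine spectralFiltration_antitone (by linarith : b ≤ b + 1) ?_
        have := (zpow_smul_mem_spectralFiltration (ht := ht) (hθ := hθ) (hL := hL) 1).2 hmb
        simpa using this
      obtain ⟨Q, hQ, hQr, hQm⟩ := ih (s + 1) (by push_cast at hk; linarith) a' ha' (t • m) h1 h2
      obtain ⟨R, hR, hRr, hRm⟩ := hmb k
      refine ⟨Q * R, mul_ne_zero hQ hR, fun β hβ => ?_, ?_⟩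
      · rcases Polynomial.root_mul.1 hβ with h | h
        exacts [hQr β h, hRr β h]
      · rw [add_smul, map_add]
        refine add_mem ?_ ?_
        · rw [algebraMap_smul, map_smul, map_mul]
          exact Submodule.smul_mem _ c
            (aeval_apply_mem (fun _ => apply_mem_zpowLattice ht hθ hL) _ hRm)
        · rw [mul_comm t, mul_smul, mul_comm Q, map_mul]
          exact aeval_apply_mem (fun _ => apply_mem_zpowLattice ht hθ hL) _ hQm
  obtain ⟨n, hn⟩ : ∃ n : ℕ, k ≤ s + n := ⟨(k - s).toNat, by have := Int.self_le_toNat (k - s); linarith⟩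
  exact key n s hn a ha m hs hm

theorem finite_quotient_of_fg (hA : ∀ a ∈ A, ∃ c : ℂ, ∃ a' ∈ A, a = algebraMap ℂ F c + t * a')
    {G : Submodule A E} (hG : G.FG) {V W : Submodule ℂ E} (hV : ∀ m, m ∈ V ↔ m ∈ G)
    (hW : ∀ m ∈ G, t • m ∈ W) : Module.Finite ℂ (V ⧸ W.submoduleOf V) := by
  obtain ⟨S, hS⟩ := hG
  have hSV : ∀ s ∈ S, s ∈ V := fun s hs => (hV s).2 (hS ▸ Submodule.subset_span hs)
  have key : V ≤ Submodule.span ℂ (S : Set E) ⊔ W := by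
    intro m hm
    rw [hV, ← hS] at hm
    induction hm using Submodule.span_induction with
    | mem x hx => exact Submodule.mem_sup_left (Submodule.subset_span hx)
    | zero => exact zero_mem _
    | add x y _ _ hx hy => exact add_mem hx hy
    | smul a x hx' hx =>
      obtain ⟨c, a', ha', e⟩ := hA a a.2
      change (a : F) • x ∈ _
      rw [e, add_smul, algebraMap_smul, mul_smul]
      refine add_mem (Submodule.smul_mem _ c hx) (Submodule.mem_sup_right (hW _ ?_))
      exact G.smul_mem (⟨a', ha'⟩ : A) (hS ▸ hx')
  let f : V →ₗ[ℂ] E ⧸ W := W.mkQ.comp V.subtype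
  have hfk : LinearMap.ker f = W.submoduleOf V := by
    ext m
    simp [f, Submodule.submoduleOf]
  have hfin : Module.Finite ℂ ((Submodule.span ℂ (S : Set E)).map W.mkQ) := by
    rw [Module.Finite.iff_fg]
    exact (Submodule.fg_span S.finite_toSet).map _
  have hle : LinearMap.range f ≤ (Submodule.span ℂ (S : Set E)).map W.mkQ := by
    rintro _ ⟨m, rfl⟩
    obtain ⟨s, hs, w, hw, e⟩ := Submodule.mem_sup.1 (key m.2)
    refine ⟨s, hs, ?_⟩
    change Submodule.Quotient.mk s = Submodule.Quotient.mk (m : E)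
    rw [← e, eq_comm, Submodule.Quotient.eq]
    simpa using hw
  have : Module.Finite ℂ (LinearMap.range f) := Submodule.finiteDimensional_of_le hle
  rw [← hfk]
  exact Module.Finite.equiv f.quotKerEquivRange.symm

theorem exists_annihilating_zpowLattice {Q₀ : Polynomial ℂ} (hQ₀ : Q₀ ≠ 0)
    (hm₀ : ∀ m ∈ L, Polynomial.aeval θ Q₀ m ∈ zpowLattice t L 1) (ht : t ≠ 0)
    (hθ : ∀ m, θ (t • m) = t • m + t • θ m) (s : ℤ) (n : ℕ) :
    ∃ R : Polynomial ℂ, R ≠ 0 ∧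
      (∀ β, R.IsRoot β → ∃ i : ℤ, s ≤ i ∧ i < s + n ∧ Q₀.IsRoot (β - i)) ∧
      ∀ m ∈ zpowLattice t L s, Polynomial.aeval θ R m ∈ zpowLattice t L (s + n) := by
  induction n with
  | zero => exact ⟨1, one_ne_zero, fun β hβ => by simp [Polynomial.IsRoot] at hβ,
      fun m hm => by simpa using hm⟩
  | succ n ih =>
    obtain ⟨R, hR, hRr, hRm⟩ := ih
    refine ⟨Q₀.comp (Polynomial.X + Polynomial.C ((-(s + n) : ℤ) : ℂ)) * R,
      mul_ne_zero (comp_X_add_C_ne_zero hQ₀ _) hR, fun β hβ => ?_, fun m hm => ?_⟩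
    · rcases Polynomial.root_mul.1 hβ with h | h
      · refine ⟨s + n, by linarith [Int.natCast_nonneg n], by push_cast; linarith, ?_⟩
        have := isRoot_comp_X_add_C.1 h
        rwa [Int.cast_neg, ← sub_eq_add_neg] at this
      · obtain ⟨i, h1, h2, h3⟩ := hRr β h
        exact ⟨i, h1, by push_cast; linarith, h3⟩
    · have h1 := hm₀ _ (hRm m hm)
      rw [aeval_zpow_smul ht hθ, zpow_smul_mem_zpowLattice ht] at h1
      have e : s + ((n + 1 : ℕ) : ℤ) = 1 - -(s + n) := by push_cast; ring
      rw [e, map_mul]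
      exact h1

/-- A connection with a finitely generated stable lattice `L` has a Deligne filtration, each step
of which is contained in some `t ^ k L`. -/
theorem exists_isDeligneFiltration [IsNoetherianRing A] (htA : t ∈ A) (ht : t ≠ 0)
    (hA : ∀ a ∈ A, ∃ c : ℂ, ∃ a' ∈ A, a = algebraMap ℂ F c + t * a')
    (hθ : ∀ m, θ (t • m) = t • m + t • θ m) (hL : ∀ m ∈ L, θ m ∈ L) (hfg : L.FG)
    (hLt : ∀ m : E, ∃ k : ℤ, m ∈ zpowLattice t L k) :
    ∃ V : ℝ → Submodule ℂ E, IsDeligneFiltration A t θ V ∧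
      ∀ b, ∃ k : ℤ, V b ≤ zpowLattice t L k := by
  let V := spectralFiltration t ht θ hθ L hL
  have hstab : ∀ k : ℤ, ∀ m ∈ zpowLattice t L k, θ m ∈ zpowLattice t L k :=
    fun k m => apply_mem_zpowLattice ht hθ hL
  have hVA : ∀ b, ∀ a ∈ A, ∀ m ∈ V b, a • m ∈ V b :=
    fun b a ha m hm => smul_mem_spectralFiltration htA hA hLt ha hm
  obtain ⟨Q₀, hQ₀, hm₀, -⟩ := exists_annihilating (θ := θ) (V := zpowLattice t L 0)
    (W := zpowLattice t L 1) (hstab 0) (hstab 1)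
    (finite_quotient_of_fg hA hfg (fun m => by simp [mem_zpowLattice]) fun m hm => by
      rw [mem_zpowLattice, smul_smul, ← zpow_add_one₀ ht]; simpa using hm)
  replace hm₀ : ∀ m ∈ L, Polynomial.aeval θ Q₀ m ∈ zpowLattice t L 1 :=
    fun m hm => hm₀ m (by simpa [mem_zpowLattice] using hm)
  have hann := exists_annihilating_zpowLattice hQ₀ hm₀ ht hθ
  let roots : Finset ℝ := Q₀.roots.toFinset.image Complex.re
  have hroots : ∀ β, Q₀.IsRoot β → β.re ∈ roots := fun β hβ =>
    Finset.mem_image_of_mem _ (Multiset.mem_toFinset.2 ((Polynomial.mem_roots hQ₀).2 hβ))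
  have hbdd : ∀ b, ∃ k : ℤ, V b ≤ zpowLattice t L k := by
    intro b
    obtain ⟨r, hr⟩ := roots.bddAbove
    refine ⟨⌊b - r⌋, fun m hm => ?_⟩
    obtain ⟨s, hs⟩ := hLt m
    rcases le_total ⌊b - r⌋ s with h | h
    · exact zpowLattice_anti ht htA L h hs
    obtain ⟨n, hn⟩ := Int.le.dest h
    obtain ⟨R, hR, hRr, hRm⟩ := hann s n
    obtain ⟨Q, hQ, hQr, hQm⟩ := hm ⌊b - r⌋
    obtain ⟨G, hG, hGr, hGm⟩ := exists_gcd_aeval_mem (hstab _) hQ hQm (hn ▸ hRm m hs)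
    have hdeg : G.degree = 0 := by
      by_contra hd
      obtain ⟨β, hβ⟩ := IsAlgClosed.exists_root G hd
      have h1 := hQr β (hGr β hβ).1
      obtain ⟨i, -, hi, h2⟩ := hRr β (hGr β hβ).2
      have h3 := hr (hroots _ h2)
      have h4 : (i : ℝ) + 1 ≤ ⌊b - r⌋ := by exact_mod_cast (by omega : i + 1 ≤ ⌊b - r⌋)
      have h5 := Int.floor_le (b - r)
      simp at h3
      linarith
    rw [Polynomial.eq_C_of_degree_eq_zero hdeg, Polynomial.aeval_C,
      Module.algebraMap_end_apply] at hGm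
    refine (Submodule.smul_mem_iff _ fun h0 => hG ?_).1 hGm
    rw [Polynomial.eq_C_of_degree_eq_zero hdeg, h0, map_zero]
  have hG : ∀ b, ∃ G : Submodule A E, G.FG ∧ ∀ m, m ∈ V b ↔ m ∈ G := by
    intro b
    obtain ⟨k, hk⟩ := hbdd b
    let f : E →ₗ[A] E :=
      { toFun := fun m => t ^ (-k) • m
        map_add' := smul_add _
        map_smul' := fun a m => smul_comm (t ^ (-k)) (a : F) m }
    have hf : Function.Injective f := fun m n h => smul_right_injective E (zpow_ne_zero _ ht) h
    let G : Submodule A E :=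
      { toAddSubmonoid := (V b).toAddSubmonoid
        smul_mem' := fun a m hm => hVA b a a.2 m hm }
    refine ⟨G, ?_, fun m => Iff.rfl⟩
    have : IsNoetherian A L := isNoetherian_of_fg_of_noetherian L hfg
    have hle : G.map f ≤ L := by
      rintro _ ⟨m, hm, rfl⟩
      exact hk hm
    exact Submodule.fg_of_fg_map_injective f hf (isNoetherian_submodule.1 this _ hle)
  have hshift : ∀ b m, m ∈ V (b + 1) ↔ ∃ n ∈ V b, m = t • n := by
    intro b m
    constructor
    · intro hm
      refine ⟨t⁻¹ • m, ?_, by rw [smul_smul, mul_inv_cancel₀ ht, one_smul]⟩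
      rw [← zpow_smul_mem_spectralFiltration 1, smul_smul]
      simpa [mul_inv_cancel₀ ht] using hm
    · rintro ⟨n, hn, rfl⟩
      simpa using (zpow_smul_mem_spectralFiltration (ht := ht) (hθ := hθ) (hL := hL) 1).2 hn
  have hθV : ∀ b, ∀ m ∈ V b, θ m ∈ V b := by
    intro b m hm k
    obtain ⟨Q, hQ, hQr, hQm⟩ := hm k
    refine ⟨Q, hQ, hQr, ?_⟩
    rw [← map_aeval_apply θ (fun _ => rfl)]
    exact hstab _ _ hQm
  refine ⟨V, ⟨spectralFiltration_antitone, fun m => ?_, fun b => ?_, hshift, ⟨roots, ?_⟩,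
    fun b => ?_, ?_⟩, hbdd⟩
  · obtain ⟨s, hs⟩ := hLt m
    obtain ⟨r, hr⟩ := roots.bddBelow
    refine ⟨r + s, fun k => ?_⟩
    rcases le_total k s with h | h
    · refine ⟨1, one_ne_zero, fun β hβ => by simp [Polynomial.IsRoot] at hβ, ?_⟩
      simpa using zpowLattice_anti ht htA L h hs
    · obtain ⟨n, rfl⟩ := Int.le.dest h
      obtain ⟨R, hR, hRr, hRm⟩ := hann s n
      refine ⟨R, hR, fun β hβ => ?_, hRm m hs⟩
      obtain ⟨i, hi, -, h2⟩ := hRr β hβ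
      have h3 := hr (hroots _ h2)
      have h4 : (s : ℝ) ≤ i := by exact_mod_cast hi
      simp at h3
      linarith
  · obtain ⟨G, ⟨S, hS⟩, hG⟩ := hG b
    refine ⟨S, le_antisymm (fun m hm => ?_)
      (generated_le (fun m hm => (hG m).2 (hS ▸ Submodule.subset_span hm)) (hVA b) (hθV b))⟩
    rw [hG, ← hS] at hm
    induction hm using Submodule.span_induction with
    | mem x hx => exact subset_generated _ _ hx
    | zero => exact zero_mem _
    | add x y _ _ hx hy => exact add_mem hx hy
    | smul a x _ hx => exact smul_mem_generated a.2 hx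
  · intro b c hbc hJ
    refine le_antisymm (fun m hm k => ?_) (spectralFiltration_antitone hbc)
    obtain ⟨Q, hQ, hQr, hQm⟩ := hm k
    obtain ⟨s, hs⟩ := hLt m
    obtain ⟨n, hn⟩ : ∃ n : ℕ, k ≤ s + n :=
      ⟨(k - s).toNat, by have := Int.self_le_toNat (k - s); linarith⟩
    obtain ⟨R, hR, hRr, hRm⟩ := hann s n
    obtain ⟨G, hG, hGr, hGm⟩ := exists_gcd_aeval_mem (hstab _) hQ hQm
      (zpowLattice_anti ht htA L hn (hRm m hs))
    refine ⟨G, hG, fun β hβ => ?_, hGm⟩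
    by_contra hlt
    obtain ⟨i, -, -, h2⟩ := hRr β (hGr β hβ).2
    refine hJ _ (hroots _ h2) i ?_
    simp only [Complex.sub_re, Complex.intCast_re, sub_add_cancel]
    exact ⟨hQr β (hGr β hβ).1, not_le.1 hlt⟩
  · obtain ⟨G, hfg, hG⟩ := hG b
    refine finite_quotient_of_fg hA hfg hG fun m hm => ?_
    rw [mem_above spectralFiltration_antitone]
    exact ⟨b + 1, by linarith, (hshift b _).2 ⟨m, (hG m).2 hm, rfl⟩⟩
  · intro b m hm hna β hβ
    rw [mem_above spectralFiltration_antitone] at hna hβ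
    obtain ⟨c, hbc, hc⟩ := hβ
    by_contra hne
    refine hna ?_
    have hmul : ∀ (Q : Polynomial ℂ), Polynomial.aeval θ (Q * (Polynomial.X - Polynomial.C β)) m =
        Polynomial.aeval θ Q (θ m - β • m) := by
      intro Q
      rw [map_mul]
      simp
    rcases lt_or_gt_of_ne hne with hlt | hgt
    · refine ⟨c, hbc, fun k => ?_⟩
      obtain ⟨Q, hQ, hQr, hQm⟩ := hm k
      obtain ⟨R, hR, hRr, hRm⟩ := hc k
      rw [← hmul] at hRm
      obtain ⟨G, hG, hGr, hGm⟩ := exists_gcd_aeval_mem (hstab _) hQ hQm hRm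
      refine ⟨G, hG, fun γ hγ => ?_, hGm⟩
      obtain ⟨h1, h2⟩ := hGr γ hγ
      rcases Polynomial.root_mul.1 h2 with h | h
      · exact hRr γ h
      · have := hQr γ h1
        rw [Polynomial.root_X_sub_C.1 h] at hlt
        linarith
    · refine ⟨min c β.re, lt_min hbc hgt, fun k => ?_⟩
      obtain ⟨R, hR, hRr, hRm⟩ := hc k
      refine ⟨R * (Polynomial.X - Polynomial.C β), mul_ne_zero hR (Polynomial.X_sub_C_ne_zero β),
        fun γ hγ => ?_, by rwa [hmul]⟩
      rcases Polynomial.root_mul.1 hγ with h | h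
      · exact (min_le_left _ _).trans (hRr γ h)
      · rw [Polynomial.root_X_sub_C.1 h]
        exact min_le_right _ _

end Existence

/-! ### Convergent power series -/

theorem inv_mem_convPS {f : ℂ⟦X⟧} (hf : f ∈ convPS) (h0 : PowerSeries.constantCoeff f ≠ 0) :
    f⁻¹ ∈ convPS := by
  obtain ⟨r, hr, hs⟩ := hf
  set a : ℕ → ℝ := fun n => ‖PowerSeries.coeff n f‖ with ha
  set c : ℝ := ‖PowerSeries.constantCoeff f‖ with hc
  have hcpos : 0 < c := norm_pos_iff.2 h0
  set B : ℝ := ∑' n, a n * r ^ n with hB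
  have hBpos : 0 ≤ B := tsum_nonneg fun n => by positivity
  -- a radius on which the non-constant part is dominated by the constant term
  set s : ℝ := min 1 (c / (B + 1)) with hs'
  have hspos : 0 < s := lt_min one_pos (by positivity)
  have hs1 : s ≤ 1 := min_le_left _ _
  have hsB : s * B ≤ c := by
    calc s * B ≤ c / (B + 1) * (B + 1) := by
          gcongr
          · exact min_le_right _ _
          · linarith
      _ = c := by field_simp
  have hsum : ∀ n : ℕ, ∑ k ∈ Finset.range n, a (k + 1) * (r * s) ^ (k + 1) ≤ c := by
    intro n
    calc ∑ k ∈ Finset.range n, a (k + 1) * (r * s) ^ (k + 1)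
        ≤ ∑ k ∈ Finset.range n, s * (a (k + 1) * r ^ (k + 1)) := by
          refine Finset.sum_le_sum fun k _ => ?_
          have h1 : s ^ (k + 1) ≤ s := by
            simpa using pow_le_pow_of_le_one hspos.le hs1 (Nat.le_add_left 1 k)
          calc a (k + 1) * (r * s) ^ (k + 1) = s ^ (k + 1) * (a (k + 1) * r ^ (k + 1)) := by
                rw [mul_pow]; ring
            _ ≤ _ := by
              have : 0 ≤ a (k + 1) * r ^ (k + 1) := by positivity
              gcongr
      _ = s * ∑ k ∈ Finset.range n, a (k + 1) * r ^ (k + 1) := by rw [Finset.mul_sum]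
      _ ≤ s * B := by
          gcongr
          calc ∑ k ∈ Finset.range n, a (k + 1) * r ^ (k + 1)
              ≤ ∑ k ∈ Finset.range (n + 1), a k * r ^ k := by
                rw [Finset.sum_range_succ']
                have : 0 ≤ a 0 * r ^ 0 := by positivity
                linarith
            _ ≤ B := hs.sum_le_tsum _ fun n _ => by positivity
      _ ≤ c := hsB
  have key : ∀ n : ℕ, ‖PowerSeries.coeff n f⁻¹‖ * (r * s) ^ n ≤ c⁻¹ := by
    intro n
    induction n using Nat.strong_induction_on with
    | _ n ih =>
      rcases Nat.eq_zero_or_pos n with rfl | hn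
      · simp [hc]
      obtain ⟨n, rfl⟩ : ∃ m, n = m + 1 := ⟨n - 1, by omega⟩
      have h1 : PowerSeries.coeff (n + 1) (f * f⁻¹) = 0 := by
        rw [PowerSeries.mul_inv_cancel _ h0, PowerSeries.coeff_one, if_neg (by omega)]
      rw [PowerSeries.coeff_mul, Finset.Nat.antidiagonal_succ, Finset.sum_cons,
        Finset.sum_map] at h1
      have h2 : PowerSeries.constantCoeff f * PowerSeries.coeff (n + 1) f⁻¹ =
          -∑ p ∈ Finset.HasAntidiagonal.antidiagonal n, PowerSeries.coeff (p.1 + 1) f *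
            PowerSeries.coeff p.2 f⁻¹ := by
        rw [eq_neg_iff_add_eq_zero]
        simpa using h1
      have h3 : c * (‖PowerSeries.coeff (n + 1) f⁻¹‖ * (r * s) ^ (n + 1)) ≤ c * c⁻¹ := by
        rw [← mul_assoc, hc, ← norm_mul, h2, norm_neg]
        calc ‖∑ p ∈ Finset.HasAntidiagonal.antidiagonal n, PowerSeries.coeff (p.1 + 1) f *
              PowerSeries.coeff p.2 f⁻¹‖ * (r * s) ^ (n + 1)
            ≤ (∑ p ∈ Finset.HasAntidiagonal.antidiagonal n, ‖PowerSeries.coeff (p.1 + 1) f *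
              PowerSeries.coeff p.2 f⁻¹‖) * (r * s) ^ (n + 1) := by
              gcongr
              exact norm_sum_le _ _
          _ = ∑ p ∈ Finset.HasAntidiagonal.antidiagonal n, (a (p.1 + 1) * (r * s) ^ (p.1 + 1)) *
              (‖PowerSeries.coeff p.2 f⁻¹‖ * (r * s) ^ p.2) := by
              rw [Finset.sum_mul]
              refine Finset.sum_congr rfl fun p hp => ?_
              rw [← Finset.HasAntidiagonal.mem_antidiagonal.1 hp, norm_mul]
              simp only [ha]
              ring
          _ ≤ ∑ p ∈ Finset.HasAntidiagonal.antidiagonal n, (a (p.1 + 1) * (r * s) ^ (p.1 + 1)) * c⁻¹ := by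
              refine Finset.sum_le_sum fun p hp => ?_
              have h4 := ih p.2 (by have := Finset.HasAntidiagonal.mem_antidiagonal.1 hp; omega)
              have : 0 ≤ a (p.1 + 1) * (r * s) ^ (p.1 + 1) := by positivity
              gcongr
          _ = (∑ k ∈ Finset.range (n + 1), a (k + 1) * (r * s) ^ (k + 1)) * c⁻¹ := by
              rw [← Finset.sum_mul, Finset.Nat.sum_antidiagonal_eq_sum_range_succ_mk]
          _ ≤ c * c⁻¹ := by
              gcongr
              exact hsum _
      exact le_of_mul_le_mul_left h3 hcpos
  refine ⟨r * s / 2, by positivity, Summable.of_nonneg_of_le (fun n => by positivity)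
    (fun n => ?_) ((summable_geometric_two).mul_left c⁻¹)⟩
  rw [div_pow, div_eq_mul_inv, ← mul_assoc, one_div, inv_pow]
  gcongr
  exact key n

theorem mem_convPS_of_X_pow_mul_mem {g : ℂ⟦X⟧} {n : ℕ}
    (h : (PowerSeries.X : ℂ⟦X⟧) ^ n * g ∈ convPS) : g ∈ convPS := by
  obtain ⟨r, hr, hs⟩ := h
  refine ⟨r, hr, ?_⟩
  have h1 := ((summable_nat_add_iff n).2 hs).mul_right (r ^ n)⁻¹
  refine h1.congr fun m => ?_
  rw [PowerSeries.coeff_X_pow_mul, pow_add]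
  field_simp

theorem exists_convPS_eq_X_pow_mul {g : ℂ⟦X⟧} (hg : g ∈ convPS) (h0 : g ≠ 0) :
    ∃ n : ℕ, ∃ u ∈ convPS, PowerSeries.constantCoeff u ≠ 0 ∧ g = PowerSeries.X ^ n * u := by
  obtain ⟨n, u, hu, e⟩ : ∃ n : ℕ, ∃ u : ℂ⟦X⟧, PowerSeries.constantCoeff u ≠ 0 ∧
      g = PowerSeries.X ^ n * u :=
    ⟨g.order.toNat, g.divXPowOrder, by
      rwa [Ne, PowerSeries.constantCoeff_divXPowOrder_eq_zero_iff],
      (PowerSeries.X_pow_order_mul_divXPowOrder).symm⟩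
  exact ⟨n, u, mem_convPS_of_X_pow_mul_mem (e ▸ hg), hu, e⟩

theorem isUnit_convPS {u : convPS} (h : PowerSeries.constantCoeff (u : ℂ⟦X⟧) ≠ 0) : IsUnit u :=
  IsUnit.of_mul_eq_one ⟨_, inv_mem_convPS u.2 h⟩ (Subtype.ext (PowerSeries.mul_inv_cancel _ h))

instance : IsNoetherianRing convPS := by
  have hX : Irreducible (⟨PowerSeries.X, X_mem_convPS⟩ : convPS) := by
    have hi : Irreducible (PowerSeries.X : ℂ⟦X⟧) := PowerSeries.X_prime.irreducible
    refine ⟨fun h => hi.1 (h.map convPS.val), fun a b hab => ?_⟩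
    have hab' : (PowerSeries.X : ℂ⟦X⟧) = a * b := congrArg Subtype.val hab
    have key : ∀ u : convPS, IsUnit (u : ℂ⟦X⟧) → IsUnit u := fun u hu =>
      isUnit_convPS (PowerSeries.isUnit_iff_constantCoeff.1 hu).ne_zero
    exact (hi.2 hab').imp (key a) (key b)
  have : IsDiscreteValuationRing convPS := by
    refine IsDiscreteValuationRing.ofHasUnitMulPowIrreducibleFactorization
      ⟨_, hX, fun {g} hg => ?_⟩
    obtain ⟨n, u, hu, hu0, e⟩ := exists_convPS_eq_X_pow_mul g.2 fun h => hg (Subtype.ext h)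
    obtain ⟨v, hv⟩ := isUnit_convPS (u := ⟨u, hu⟩) hu0
    exact ⟨n, v, Subtype.ext (by rw [hv]; exact e.symm)⟩
  infer_instance

/-! ### Coefficients of Laurent series -/

theorem ofPS_injective : Function.Injective ofPS := HahnSeries.ofPowerSeries_injective

theorem mem_range_ofPS {f : Laurent} : f ∈ ofPS.range ↔ ∀ n < 0, f.coeff n = 0 := by
  constructor
  · rintro ⟨g, rfl⟩ n hn
    exact coeff_ofPS_of_neg g hn
  · intro h
    refine ⟨PowerSeries.mk fun n => f.coeff n, Laurent.ext fun n => ?_⟩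
    change (ofPS _).coeff n = _
    rcases lt_or_ge n 0 with hn | hn
    · rw [coeff_ofPS_of_neg _ hn, h n hn]
    · lift n to ℕ using hn
      rw [coeff_ofPS_natCast, PowerSeries.coeff_mk]

theorem Laurent.x_zpow (k : ℤ) : Laurent.x ^ k = (HahnSeries.single k 1 : ℂ⸨X⸩) := by
  have hnat : ∀ n : ℕ, Laurent.x ^ n = (HahnSeries.single (n : ℤ) 1 : ℂ⸨X⸩) := by
    intro n
    rw [Laurent.x_eq]
    have := HahnSeries.single_pow (Γ := ℤ) (R := ℂ) 1 n 1
    simp only [one_pow, nsmul_eq_mul, mul_one] at this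
    exact this
  obtain ⟨n, rfl | rfl⟩ := k.eq_nat_or_neg
  · rw [zpow_natCast]; exact hnat n
  · rw [zpow_neg, zpow_natCast]
    refine inv_eq_of_mul_eq_one_right ?_
    rw [hnat]
    refine (HahnSeries.single_mul_single (Γ := ℤ) (R := ℂ)).trans ?_
    rw [add_neg_cancel, one_mul]
    rfl

theorem Laurent.coeff_zpow_mul (k : ℤ) (f : Laurent) (n : ℤ) :
    (Laurent.x ^ k * f).coeff n = f.coeff (n - k) := by
  rw [Laurent.x_zpow]
  have := HahnSeries.coeff_single_mul_add (Γ := ℤ) (R := ℂ) (r := 1) (x := f) (a := n - k) (b := k)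
  rw [sub_add_cancel, one_mul] at this
  exact this

theorem Laurent.coeff_x_pow (k : ℕ) (n : ℤ) :
    (Laurent.x ^ k).coeff n = if n = k then 1 else 0 := by
  rw [← zpow_natCast, Laurent.x_zpow]
  change HahnSeries.coeff (HahnSeries.single (k : ℤ) (1 : ℂ)) n = _
  rw [HahnSeries.coeff_single]
  congr 1

/-- The bound below on the exponents of a Laurent series. -/
theorem Laurent.exists_coeff_eq_zero (f : Laurent) : ∃ k : ℤ, ∀ n < k, f.coeff n = 0 :=
  ⟨HahnSeries.order (f : ℂ⸨X⸩), fun _ hn => HahnSeries.coeff_eq_zero_of_lt_order hn⟩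

theorem Laurent.coeff_inv_eq_zero {h : Laurent} (h0 : h ≠ 0) (hneg : ∀ n : ℤ, 0 ≤ n → h.coeff n = 0)
    {n : ℤ} (hn : n < 1) : (h⁻¹).coeff n = 0 := by
  have h1 : HahnSeries.order ((h : ℂ⸨X⸩) * (h⁻¹ : Laurent)) = 0 := by
    have : (h * h⁻¹ : Laurent) = 1 := mul_inv_cancel₀ h0
    change HahnSeries.order (h * h⁻¹ : Laurent) = 0
    rw [this]
    exact HahnSeries.order_one
  have h2 : HahnSeries.order ((h : ℂ⸨X⸩) * (h⁻¹ : Laurent)) = HahnSeries.order (h : ℂ⸨X⸩) +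
      HahnSeries.order (h⁻¹ : Laurent) :=
    HahnSeries.order_mul h0 (inv_ne_zero h0)
  have h3 : HahnSeries.order (h : ℂ⸨X⸩) < 0 := by
    by_contra hge
    exact HahnSeries.coeff_order_eq_zero.not.2 h0 (hneg _ (not_lt.1 hge))
  exact HahnSeries.coeff_eq_zero_of_lt_order (by omega)

/-! ### The field of convergent Laurent series -/

theorem isField_convLaurent : IsField ConvLaurent := by
  refine ⟨⟨0, 1, zero_ne_one⟩, mul_comm, fun {f} hf => ?_⟩
  obtain ⟨f, k, g, hg, e⟩ := f
  have hf0 : f ≠ 0 := fun h => hf (Subtype.ext h)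
  have hg0 : g ≠ 0 := by
    rintro rfl
    rw [map_zero, mul_eq_zero] at e
    exact e.elim (pow_ne_zero _ Laurent.x_ne_zero) hf0
  obtain ⟨n, u, hu, hu0, rfl⟩ := exists_convPS_eq_X_pow_mul hg hg0
  have huu : ofPS u * ofPS u⁻¹ = 1 := by
    rw [← map_mul, PowerSeries.mul_inv_cancel _ hu0, map_one]
  refine ⟨⟨f⁻¹, n, PowerSeries.X ^ k * u⁻¹,
    mul_mem (pow_mem X_mem_convPS _) (inv_mem_convPS hu hu0), ?_⟩,
    Subtype.ext (mul_inv_cancel₀ hf0)⟩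
  rw [map_mul, map_pow] at e ⊢
  change Laurent.x ^ k * f = Laurent.x ^ n * _ at e
  change _ = Laurent.x ^ k * _
  rw [mul_inv_eq_iff_eq_mul₀ hf0]
  calc Laurent.x ^ n = Laurent.x ^ n * (ofPS u * ofPS u⁻¹) := by rw [huu, mul_one]
    _ = (Laurent.x ^ k * f) * ofPS u⁻¹ := by rw [e]; ring
    _ = _ := by ring

instance : Field ConvLaurent := isField_convLaurent.toField

theorem mem_convIntegers {f : ConvLaurent} :
    f ∈ convIntegers ↔ ∀ n < 0, Laurent.coeff (f : Laurent) n = 0 := by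
  constructor
  · rintro ⟨g, -, e⟩ n hn
    change ofPS g = (f : Laurent) at e
    rw [← e]
    exact coeff_ofPS_of_neg g hn
  · intro h
    obtain ⟨g, hg⟩ := mem_range_ofPS.2 h
    change ofPS g = (f : Laurent) at hg
    obtain ⟨k, g', hg', e⟩ := f.2
    refine ⟨g, mem_convPS_of_X_pow_mul_mem (n := k) ?_, hg⟩
    convert hg'
    apply ofPS_injective
    rw [← e, ← hg, map_mul, map_pow]
    rfl

instance : IsNoetherianRing convIntegers := by
  let f : convPS →+* convIntegers :=
    { toFun := fun g => ⟨⟨ofPS g, 0, g, g.2, by rw [pow_zero, one_mul]⟩, g, g.2, rfl⟩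
      map_one' := by ext1; ext1; exact map_one ofPS
      map_zero' := by ext1; ext1; exact map_zero ofPS
      map_mul' := fun a b => by ext1; ext1; exact map_mul ofPS _ _
      map_add' := fun a b => by ext1; ext1; exact map_add ofPS _ _ }
  refine isNoetherianRing_of_surjective convPS convIntegers f ?_
  rintro ⟨h, g, hg, e⟩
  exact ⟨⟨g, hg⟩, Subtype.ext (Subtype.ext e)⟩

/-! ### The ramified field -/

variable {q : ℕ+}

theorem mem_formalIntegers {f : Ram q} :
    f ∈ formalIntegers q ↔ ∀ n < 0, Laurent.coeff f n = 0 := mem_range_ofPS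

instance : IsNoetherianRing (formalIntegers q) :=
  isNoetherianRing_of_surjective ℂ⟦X⟧ _ (ofPS.rangeRestrict : ℂ⟦X⟧ →ₐ[ℂ] ofPS.range).toRingHom
    ofPS.rangeRestrict_surjective

theorem Ram.y_ne_zero : Ram.y q ≠ 0 := Laurent.x_ne_zero

theorem Ram.y_mem : Ram.y q ∈ formalIntegers q := ⟨PowerSeries.X, rfl⟩

theorem Ram.euler_y : Ram.euler q (Ram.y q) = Ram.y q := by
  have := Laurent.euler_x_pow 1
  rw [pow_one, Nat.cast_one, one_mul] at this
  exact this

theorem Ram.coeff_zpow_mul (k : ℤ) (f : Ram q) (n : ℤ) :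
    Laurent.coeff (Ram.y q ^ k * f) n = Laurent.coeff f (n - k) := Laurent.coeff_zpow_mul k f n

theorem Ram.exists_zpow_mul_mem (f : Ram q) : ∃ k : ℤ, Ram.y q ^ (-k) * f ∈ formalIntegers q := by
  obtain ⟨k, hk⟩ := Laurent.exists_coeff_eq_zero f
  refine ⟨k, mem_formalIntegers.2 fun n hn => ?_⟩
  rw [Ram.coeff_zpow_mul]
  exact hk _ (by omega)

theorem Ram.exists_eq_add_y_mul {a : Ram q} (ha : a ∈ formalIntegers q) :
    ∃ c : ℂ, ∃ a' ∈ formalIntegers q, a = algebraMap ℂ (Ram q) c + Ram.y q * a' := by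
  obtain ⟨g, rfl⟩ := ha
  refine ⟨PowerSeries.constantCoeff g, ofPS (PowerSeries.mk fun n => PowerSeries.coeff (n + 1) g),
    ⟨_, rfl⟩, ?_⟩
  change ofPS g = _
  conv_lhs => rw [PowerSeries.eq_X_mul_shift_add_const g]
  rw [map_add, map_mul, add_comm]
  congr 1
  exact ofPS.commutes _

theorem Ram.euler_mem {a : Ram q} (ha : a ∈ formalIntegers q) :
    Ram.euler q a ∈ formalIntegers q := by
  rw [mem_formalIntegers] at ha ⊢
  intro n hn
  refine (Laurent.coeff_euler a n).trans ?_
  rw [ha n hn, mul_zero]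

theorem eq_zero_of_forall_mem {f : Ram q} (h : ∀ k : ℕ, Ram.y q ^ (-(k : ℤ)) * f ∈ formalIntegers q) :
    f = 0 := by
  refine Laurent.ext fun n => ?_
  change Laurent.coeff f n = 0
  have := mem_formalIntegers.1 (h (n + 1).toNat) (n - (n + 1).toNat)
    (by have := Int.self_le_toNat (n + 1); omega)
  rw [Ram.coeff_zpow_mul] at this
  convert this using 2
  omega

theorem IsPolar.exists_mul_euler {φ : Ram q} (hφ : IsPolar φ) (h0 : φ ≠ 0) :
    ∃ g ∈ formalIntegers q, g * Ram.euler q φ = (Ram.y q)⁻¹ := by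
  have hc : ∀ n, Laurent.coeff (Ram.euler q φ) n = n * Laurent.coeff φ n :=
    fun n => Laurent.coeff_euler φ n
  have h1 : Ram.euler q φ ≠ 0 := by
    intro h
    refine h0 (Laurent.ext fun n => ?_)
    change Laurent.coeff φ n = 0
    rcases eq_or_ne n 0 with rfl | hn
    · exact hφ 0 le_rfl
    · have := hc n
      rw [h] at this
      change 0 = _ at this
      exact (mul_eq_zero.1 this.symm).resolve_left (by exact_mod_cast hn)
  refine ⟨(Ram.y q)⁻¹ * (Ram.euler q φ)⁻¹, mem_formalIntegers.2 fun n hn => ?_, ?_⟩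
  · rw [← zpow_neg_one, Ram.coeff_zpow_mul]
    exact Laurent.coeff_inv_eq_zero h1 (fun m hm => by rw [hc, hφ m hm, mul_zero]) (by omega)
  · rw [mul_assoc, inv_mul_cancel₀ h1, mul_one]

theorem algebraMap_eq_ramify (f : ConvLaurent) : algebraMap ConvLaurent (Ram q) f = ramify q f :=
  rfl

theorem coeff_ramify_mul (f : Laurent) (m : ℤ) :
    Laurent.coeff (ramify q f) ((q : ℕ) * m) = f.coeff m :=
  HahnSeries.embDomain_coeff (a := m)

theorem coeff_ramify_of_not_dvd (f : Laurent) {n : ℤ} (hn : ¬ ((q : ℕ) : ℤ) ∣ n) :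
    Laurent.coeff (ramify q f) n = 0 :=
  HahnSeries.embDomain_of_notMem_range (by
    rintro ⟨m, hm⟩
    exact hn ⟨m, hm.symm⟩)

theorem ramify_x : ramify q Laurent.x = Ram.y q ^ (q : ℕ) := by
  refine Laurent.ext fun n => ?_
  change Laurent.coeff (ramify q Laurent.x) n = Laurent.coeff (Laurent.x ^ (q : ℕ)) n
  rw [Laurent.coeff_x_pow]
  have hx : ∀ m : ℤ, Laurent.x.coeff m = if m = 1 then 1 else 0 := fun m => by
    simpa using Laurent.coeff_x_pow 1 m
  by_cases hn : ((q : ℕ) : ℤ) ∣ n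
  · obtain ⟨m, rfl⟩ := hn
    rw [coeff_ramify_mul, hx]
    have hq : ((q : ℕ) : ℤ) ≠ 0 := by exact_mod_cast q.ne_zero
    congr 1
    rw [eq_iff_iff]
    exact ⟨fun h => by rw [h, mul_one], fun h => mul_left_cancel₀ hq (by rw [h, mul_one])⟩
  · rw [coeff_ramify_of_not_dvd _ hn, if_neg]
    rintro rfl
    exact hn dvd_rfl

theorem algebraMap_x : algebraMap ConvLaurent (Ram q) ConvLaurent.x = Ram.y q ^ (q : ℕ) := ramify_x

theorem algebraMap_mem_formalIntegers {f : ConvLaurent} :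
    algebraMap ConvLaurent (Ram q) f ∈ formalIntegers q ↔ f ∈ convIntegers := by
  rw [mem_formalIntegers, mem_convIntegers, algebraMap_eq_ramify]
  have hq : (0 : ℤ) < (q : ℕ) := by exact_mod_cast q.pos
  constructor
  · intro h n hn
    rw [← coeff_ramify_mul (q := q)]
    exact h _ (mul_neg_of_pos_of_neg hq hn)
  · intro h n hn
    by_cases hd : ((q : ℕ) : ℤ) ∣ n
    · obtain ⟨m, rfl⟩ := hd
      rw [coeff_ramify_mul]
      exact h m (neg_of_mul_neg_right hn hq.le)
    · exact coeff_ramify_of_not_dvd _ hd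

theorem ConvLaurent.x_ne_zero : ConvLaurent.x ≠ 0 := fun h =>
  Laurent.x_ne_zero (congrArg Subtype.val h)

theorem ConvLaurent.x_mem : ConvLaurent.x ∈ convIntegers := ⟨_, X_mem_convPS, rfl⟩

theorem Ram.algebraMap_x_zpow (k : ℤ) :
    algebraMap ConvLaurent (Ram q) (ConvLaurent.x ^ k) = Ram.y q ^ ((q : ℕ) * k) := by
  rw [map_zpow₀, algebraMap_x, ← zpow_natCast, ← zpow_mul]

/-! ### The projection of `ℂ((y))` on `ℂ((x))` -/

/-- Keep only the powers of `y` whose exponent is a multiple of `q`. -/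
def projCoeff (f : Ram q) : Ram q :=
  (⟨fun n => if ((q : ℕ) : ℤ) ∣ n then Laurent.coeff f n else 0,
    (HahnSeries.isPWO_support (f : ℂ⸨X⸩)).mono fun n hn h => hn (by
      change Laurent.coeff f n = 0 at h
      simp [h])⟩ : ℂ⸨X⸩)

theorem coeff_projCoeff (f : Ram q) (n : ℤ) :
    Laurent.coeff (projCoeff f) n = if ((q : ℕ) : ℤ) ∣ n then Laurent.coeff f n else 0 := rfl

theorem projCoeff_ramify_mul (f : Laurent) (g : Ram q) :
    projCoeff (ramify q f * g) = ramify q f * projCoeff g := by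
  refine Laurent.ext fun n => ?_
  have hsupp : HahnSeries.support (projCoeff g : ℂ⸨X⸩) ⊆ HahnSeries.support (g : ℂ⸨X⸩) := by
    intro m hm h0
    refine hm ?_
    change Laurent.coeff (projCoeff g) m = 0
    change Laurent.coeff g m = 0 at h0
    rw [coeff_projCoeff, h0, ite_self]
  have e1 : Laurent.coeff (ramify q f * g) n = _ :=
    HahnSeries.coeff_mul (x := (ramify q f : ℂ⸨X⸩)) (y := (g : ℂ⸨X⸩)) (a := n)
  have e2 : Laurent.coeff (ramify q f * projCoeff g) n = _ :=
    HahnSeries.coeff_mul_right' (x := (ramify q f : ℂ⸨X⸩))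
      (y := (projCoeff g : ℂ⸨X⸩)) (a := n) (HahnSeries.isPWO_support _) hsupp
  rw [coeff_projCoeff, e1, e2]
  have key : ∀ p : ℤ × ℤ, p.1 + p.2 = n →
      HahnSeries.coeff (ramify q f : ℂ⸨X⸩) p.1 * HahnSeries.coeff (projCoeff g : ℂ⸨X⸩) p.2 =
      if ((q : ℕ) : ℤ) ∣ n then
        HahnSeries.coeff (ramify q f : ℂ⸨X⸩) p.1 * HahnSeries.coeff (g : ℂ⸨X⸩) p.2 else 0 := by
    intro p hp
    change Laurent.coeff (ramify q f) p.1 * Laurent.coeff (projCoeff g) p.2 =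
      if ((q : ℕ) : ℤ) ∣ n then Laurent.coeff (ramify q f) p.1 * Laurent.coeff g p.2 else 0
    by_cases h1 : ((q : ℕ) : ℤ) ∣ p.1
    · have h2 : ((q : ℕ) : ℤ) ∣ p.2 ↔ ((q : ℕ) : ℤ) ∣ n := by rw [← hp, Int.dvd_add_right h1]
      rw [coeff_projCoeff]
      by_cases h3 : ((q : ℕ) : ℤ) ∣ n
      · rw [if_pos h3, if_pos (h2.2 h3)]
      · rw [if_neg h3, if_neg fun h => h3 (h2.1 h), mul_zero]
    · rw [coeff_ramify_of_not_dvd _ h1, zero_mul, zero_mul, ite_self]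
  rw [Finset.sum_congr rfl fun p hp => key p (Finset.mem_antidiagonal.1 hp).2.2]
  split_ifs with h
  · rfl
  · rw [Finset.sum_const_zero]

/-- The `ℂ((x))`-linear projection of `ℂ((y))` on `ℂ((x))`. -/
def Ram.proj (q : ℕ+) : Ram q →ₗ[ConvLaurent] Ram q where
  toFun := projCoeff
  map_add' f g := Laurent.ext fun n => by
    change Laurent.coeff (projCoeff (f + g)) n =
      Laurent.coeff (projCoeff f) n + Laurent.coeff (projCoeff g) n
    simp only [coeff_projCoeff]
    split_ifs
    · rfl
    · rw [add_zero]
  map_smul' c f := by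
    rw [Algebra.smul_def, algebraMap_eq_ramify, projCoeff_ramify_mul]
    rfl

theorem Ram.coeff_proj (f : Ram q) (n : ℤ) :
    Laurent.coeff (Ram.proj q f) n = if ((q : ℕ) : ℤ) ∣ n then Laurent.coeff f n else 0 := rfl

theorem Ram.proj_one : Ram.proj q 1 = 1 := by
  refine Laurent.ext fun n => ?_
  change Laurent.coeff (Ram.proj q 1) n = Laurent.coeff 1 n
  have h := Laurent.coeff_x_pow 0 n
  rw [pow_zero] at h
  rw [Ram.coeff_proj]
  change (if _ then Laurent.coeff 1 n else 0) = _
  rw [h]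
  split_ifs with h1 h2 h2
  · rfl
  · rfl
  · rw [h2] at h1
    exact absurd (dvd_zero _) h1
  · rfl

theorem Ram.proj_euler (f : Ram q) : Ram.proj q (Ram.euler q f) = Ram.euler q (Ram.proj q f) := by
  refine Laurent.ext fun n => ?_
  have h : ∀ f : Ram q, Laurent.coeff (Ram.euler q f) n = n * Laurent.coeff f n :=
    fun f => Laurent.coeff_euler f n
  change Laurent.coeff (Ram.proj q _) n = Laurent.coeff (Ram.euler q _) n
  rw [Ram.coeff_proj, h, h, Ram.coeff_proj, mul_ite, mul_zero]

theorem Ram.proj_mem {f : Ram q} (hf : f ∈ formalIntegers q) : Ram.proj q f ∈ formalIntegers q := by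
  rw [mem_formalIntegers] at hf ⊢
  intro n hn
  rw [Ram.coeff_proj, hf n hn, ite_self]

/-- Truncation of the projection of a formal power series. -/
theorem Ram.exists_proj_sub_mem {g : Ram q} (hg : g ∈ formalIntegers q) (k : ℕ) :
    ∃ a ∈ convIntegers, Ram.y q ^ (-((q : ℕ) * k : ℤ)) *
      (Ram.proj q g - algebraMap ConvLaurent (Ram q) a) ∈ formalIntegers q := by
  let p : ℂ⟦X⟧ := PowerSeries.mk fun n =>
    if n < k then Laurent.coeff g ((q : ℕ) * (n : ℤ)) else 0
  have hp : p ∈ convPS := by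
    refine ⟨1, one_pos, summable_of_ne_finset_zero (s := Finset.range k) fun n hn => ?_⟩
    rw [PowerSeries.coeff_mk, if_neg (by simpa using hn), norm_zero, zero_mul]
  refine ⟨⟨ofPS p, 0, p, hp, by rw [pow_zero, one_mul]⟩, ⟨p, hp, rfl⟩, ?_⟩
  rw [mem_formalIntegers] at hg ⊢
  intro n hn
  rw [Ram.coeff_zpow_mul, sub_neg_eq_add]
  change Laurent.coeff (Ram.proj q g) (n + (q : ℕ) * k) -
    Laurent.coeff (ramify q (ofPS p)) (n + (q : ℕ) * k) = 0
  rw [Ram.coeff_proj]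
  have hq : (0 : ℤ) < (q : ℕ) := by exact_mod_cast q.pos
  split_ifs with hd
  · obtain ⟨m, hm⟩ := hd
    rw [hm, coeff_ramify_mul]
    rcases lt_or_ge m 0 with hm0 | hm0
    · rw [coeff_ofPS_of_neg _ hm0, hg _ (mul_neg_of_pos_of_neg hq hm0), sub_zero]
    · lift m to ℕ using hm0
      have hmk : m < k := by
        have h1 : ((q : ℕ) : ℤ) * m < (q : ℕ) * k := by omega
        exact_mod_cast lt_of_mul_lt_mul_left h1 hq.le
      rw [coeff_ofPS_natCast, PowerSeries.coeff_mk, if_pos hmk, sub_self]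
  · rw [coeff_ramify_of_not_dvd _ hd, sub_zero]

theorem IsDeligneFiltration.zpow_smul_mem {F : Type*} [Field F] [Algebra ℂ F] {A : Subalgebra ℂ F}
    {E : Type*} [AddCommGroup E] [Module ℂ E] [Module F E] {t : F} (ht : t ≠ 0)
    {θ : Module.End ℂ E} {V : ℝ → Submodule ℂ E} (h : IsDeligneFiltration A t θ V) {b : ℝ} (k : ℤ)
    {m : E} : t ^ k • m ∈ V (b + k) ↔ m ∈ V b := by
  have hnat : ∀ (b : ℝ) (k : ℕ) (m : E), t ^ k • m ∈ V (b + k) ↔ m ∈ V b := by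
    intro b k m
    rw [h.mem_add_natCast]
    constructor
    · rintro ⟨n, hn, e⟩
      rwa [smul_right_injective E (pow_ne_zero k ht) e]
    · exact fun hm => ⟨m, hm, rfl⟩
  obtain ⟨n, rfl | rfl⟩ := k.eq_nat_or_neg
  · simpa using hnat b n m
  · rw [← hnat _ n, smul_smul, ← zpow_natCast, ← zpow_add₀ ht]
    simp

theorem exists_mem_zpowLattice {q : ℕ+} {E : Type*} [AddCommGroup E] [Module ℂ E] [Module (Ram q) E]
    [IsScalarTower ℂ (Ram q) E] {L : Submodule (formalIntegers q) E}
    (hL : Submodule.span (Ram q) (L : Set E) = ⊤) (m : E) :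
    ∃ k : ℤ, m ∈ zpowLattice (Ram.y q) L k := by
  have hm : m ∈ Submodule.span (Ram q) (L : Set E) := hL ▸ Submodule.mem_top
  induction hm using Submodule.span_induction with
  | mem x hx => exact ⟨0, by simpa [mem_zpowLattice] using hx⟩
  | zero => exact ⟨0, zero_mem _⟩
  | add x y _ _ hx hy =>
    obtain ⟨k, hk⟩ := hx
    obtain ⟨l, hl⟩ := hy
    exact ⟨min k l, add_mem (zpowLattice_anti Ram.y_ne_zero Ram.y_mem L (min_le_left k l) hk)
      (zpowLattice_anti Ram.y_ne_zero Ram.y_mem L (min_le_right k l) hl)⟩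
  | smul f x _ hx =>
    obtain ⟨k, hk⟩ := hx
    obtain ⟨l, hl⟩ := Ram.exists_zpow_mul_mem f
    refine ⟨l + k, ?_⟩
    have h := smul_mem_zpowLattice hl hk
    rwa [mul_smul, zpow_smul_mem_zpowLattice Ram.y_ne_zero, sub_neg_eq_add, add_comm k] at h

/-- A linear map from a finitely generated lattice to a space exhausted by the multiples of a
lattice is bounded. -/
theorem exists_map_mem_zpowLattice {q : ℕ+} {E E' : Type*} [AddCommGroup E] [Module ℂ E]
    [Module (Ram q) E] [IsScalarTower ℂ (Ram q) E] [AddCommGroup E'] [Module ℂ E']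
    [Module (Ram q) E'] [IsScalarTower ℂ (Ram q) E'] {L : Submodule (formalIntegers q) E}
    (hL : L.FG) (f : E →ₗ[Ram q] E') {W : Submodule (formalIntegers q) E'}
    (hW : ∀ m, ∃ k : ℤ, m ∈ zpowLattice (Ram.y q) W k) :
    ∃ k : ℤ, ∀ m ∈ L, f m ∈ zpowLattice (Ram.y q) W k := by
  obtain ⟨S, rfl⟩ := hL
  choose g hg using hW
  obtain ⟨k, hk⟩ := (S.image (g ∘ f)).bddBelow
  refine ⟨k, fun m hm => ?_⟩
  induction hm using Submodule.span_induction with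
  | mem x hx =>
    exact zpowLattice_anti Ram.y_ne_zero Ram.y_mem W
      (hk (Finset.mem_coe.2 (Finset.mem_image_of_mem _ hx))) (hg (f x))
  | zero => rw [map_zero]; exact zero_mem _
  | add x y _ _ hx hy => rw [map_add]; exact add_mem hx hy
  | smul a x _ hx =>
    have : f (a • x) = (a : Ram q) • f x := f.map_smul (a : Ram q) x
    rw [this]
    exact smul_mem_zpowLattice a.2 hx

namespace Connection

variable {M : Type*} [AddCommGroup M] [Module ℂ M] [Module ConvLaurent M]
  [IsScalarTower ℂ ConvLaurent M] (C : Connection M) {q : ℕ+}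

theorem pullbackEuler_smul (f : Ram q) (n : Ram q ⊗[ConvLaurent] M) :
    C.pullbackEuler q (f • n) = Ram.euler q f • n + f • C.pullbackEuler q n := by
  induction n using TensorProduct.induction_on with
  | zero => simp
  | tmul g m =>
    rw [TensorProduct.smul_tmul', pullbackEuler_tmul, pullbackEuler_tmul, smul_eq_mul,
      Ram.euler_mul, TensorProduct.add_tmul, smul_add, TensorProduct.smul_tmul',
      TensorProduct.smul_tmul', TensorProduct.smul_tmul', smul_eq_mul, smul_eq_mul, smul_eq_mul,
      add_assoc]
  | add a b ha hb =>
    rw [smul_add, map_add, ha, hb, map_add, smul_add, smul_add]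
    abel

/-- The map `m ↦ 1 ⊗ m`. -/
abbrev unitMap (q : ℕ+) (M : Type*) [AddCommGroup M] [Module ConvLaurent M] :
    M →ₗ[ConvLaurent] Ram q ⊗[ConvLaurent] M := TensorProduct.mk ConvLaurent (Ram q) M 1

theorem pullbackEuler_unitMap (m : M) :
    C.pullbackEuler q (unitMap q M m) = ((q : ℕ) : ℂ) • unitMap q M (C.euler m) := by
  have h1 : Ram.euler q 1 = 0 := by
    have := Ram.euler_mul q 1 1
    simpa using this
  change C.pullbackEuler q (1 ⊗ₜ m) = _
  rw [pullbackEuler_tmul, h1, TensorProduct.zero_tmul, zero_add, TensorProduct.tmul_smul,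
    Nat.cast_smul_eq_nsmul]
  rfl

theorem unitMap_smul (f : ConvLaurent) (m : M) :
    unitMap q M (f • m) = algebraMap ConvLaurent (Ram q) f • unitMap q M m := by
  rw [map_smul, algebraMap_smul]

theorem unitMap_x_zpow_smul (k : ℤ) (m : M) :
    unitMap q M (ConvLaurent.x ^ k • m) = Ram.y q ^ ((q : ℕ) * k : ℤ) • unitMap q M m := by
  rw [unitMap_smul, Ram.algebraMap_x_zpow]

theorem unitMap_complex_smul (c : ℂ) (m : M) :
    unitMap q M (c • m) = c • unitMap q M m := by
  rw [← algebraMap_smul ConvLaurent c m, map_smul, algebraMap_smul]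

/-- The projection `e ⊗ 1` of `ℂ((y)) ⊗ M` on `ℂ((x)) ⊗ M`. -/
def invariantProj (q : ℕ+) (M : Type*) [AddCommGroup M] [Module ConvLaurent M] :
    Ram q ⊗[ConvLaurent] M →ₗ[ConvLaurent] Ram q ⊗[ConvLaurent] M :=
  TensorProduct.map (Ram.proj q) LinearMap.id

theorem invariantProj_tmul (g : Ram q) (m : M) :
    invariantProj q M (g ⊗ₜ m) = Ram.proj q g ⊗ₜ m := rfl

theorem invariantProj_unitMap (m : M) : invariantProj q M (unitMap q M m) = unitMap q M m := by
  change invariantProj q M (1 ⊗ₜ m) = 1 ⊗ₜ m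
  rw [invariantProj_tmul, Ram.proj_one]

theorem invariantProj_smul_unitMap (g : Ram q) (m : M) :
    invariantProj q M (g • unitMap q M m) = Ram.proj q g • unitMap q M m := by
  change invariantProj q M (g • (1 ⊗ₜ m)) = Ram.proj q g • (1 ⊗ₜ m)
  rw [TensorProduct.smul_tmul', TensorProduct.smul_tmul', invariantProj_tmul, smul_eq_mul, mul_one,
    smul_eq_mul, mul_one]

theorem invariantProj_zpow_smul (k : ℤ) (n : Ram q ⊗[ConvLaurent] M) :
    invariantProj q M (Ram.y q ^ ((q : ℕ) * k : ℤ) • n) =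
      Ram.y q ^ ((q : ℕ) * k : ℤ) • invariantProj q M n := by
  rw [← Ram.algebraMap_x_zpow, algebraMap_smul, map_smul, algebraMap_smul]

theorem invariantProj_pullbackEuler (n : Ram q ⊗[ConvLaurent] M) :
    invariantProj q M (C.pullbackEuler q n) = C.pullbackEuler q (invariantProj q M n) := by
  induction n using TensorProduct.induction_on with
  | zero => simp
  | tmul g m =>
    rw [pullbackEuler_tmul, map_add, invariantProj_tmul, invariantProj_tmul, invariantProj_tmul,
      pullbackEuler_tmul, Ram.proj_euler]
  | add a b ha hb => simp only [map_add, ha, hb]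

section Lattice

variable {ι : Type*} (B : Module.Basis ι ConvLaurent M)

/-- The lattice of `ℂ((y)) ⊗ M` generated by a basis of `M`. -/
def basisLattice (q : ℕ+) : Submodule (formalIntegers q) (Ram q ⊗[ConvLaurent] M) where
  carrier := {n | ∀ i, (B.baseChange (Ram q)).repr n i ∈ formalIntegers q}
  add_mem' := fun h h' i => by
    rw [map_add, Finsupp.add_apply]
    exact add_mem (h i) (h' i)
  zero_mem' := fun i => by
    rw [map_zero, Finsupp.zero_apply]
    exact zero_mem _
  smul_mem' := fun a n h i => by
    have : (B.baseChange (Ram q)).repr (a • n) = (a : Ram q) • (B.baseChange (Ram q)).repr n :=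
      map_smul (B.baseChange (Ram q)).repr (a : Ram q) n
    rw [this, Finsupp.smul_apply]
    exact mul_mem a.2 (h i)

theorem mem_basisLattice {n : Ram q ⊗[ConvLaurent] M} : n ∈ basisLattice B q ↔
    ∀ i, (B.baseChange (Ram q)).repr n i ∈ formalIntegers q := Iff.rfl

theorem repr_invariantProj (n : Ram q ⊗[ConvLaurent] M) (i : ι) :
    (B.baseChange (Ram q)).repr (invariantProj q M n) i =
      Ram.proj q ((B.baseChange (Ram q)).repr n i) := by
  induction n using TensorProduct.induction_on with
  | zero => simp
  | tmul g m =>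
    rw [invariantProj_tmul, Module.Basis.baseChange_repr_tmul, Module.Basis.baseChange_repr_tmul,
      map_smul]
  | add a b ha hb => simp only [map_add, Finsupp.add_apply, ha, hb]

theorem invariantProj_mem_zpowLattice {k : ℤ} {n : Ram q ⊗[ConvLaurent] M}
    (hn : n ∈ zpowLattice (Ram.y q) (basisLattice B q) ((q : ℕ) * k)) :
    invariantProj q M n ∈ zpowLattice (Ram.y q) (basisLattice B q) ((q : ℕ) * k) := by
  rw [mem_zpowLattice, ← mul_neg] at hn ⊢
  rw [← invariantProj_zpow_smul]
  intro i
  rw [repr_invariantProj]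
  exact Ram.proj_mem (hn i)

theorem eq_zero_of_forall_mem_zpowLattice {n : Ram q ⊗[ConvLaurent] M}
    (h : ∀ k : ℕ, n ∈ zpowLattice (Ram.y q) (basisLattice B q) k) : n = 0 := by
  refine (B.baseChange (Ram q)).repr.injective (Finsupp.ext fun i => ?_)
  rw [map_zero, Finsupp.zero_apply]
  refine eq_zero_of_forall_mem fun k => ?_
  have := h k i
  rwa [map_smul, Finsupp.smul_apply] at this

theorem exists_mem_zpowLattice_basisLattice [Finite ι] (n : Ram q ⊗[ConvLaurent] M) :
    ∃ k : ℤ, n ∈ zpowLattice (Ram.y q) (basisLattice B q) k := by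
  classical
  refine exists_mem_zpowLattice ?_ n
  rw [eq_top_iff, ← (B.baseChange (Ram q)).span_eq]
  refine Submodule.span_mono ?_
  rintro _ ⟨i, rfl⟩ j
  rw [Module.Basis.repr_self, Finsupp.single_apply]
  split_ifs
  exacts [one_mem _, zero_mem _]

end Lattice

namespace ElementaryModel

variable {M : Type*} [AddCommGroup M] [Module ℂ M] [Module ConvLaurent M]
  [IsScalarTower ℂ ConvLaurent M] {C : Connection M} {q : ℕ+} (S : C.ElementaryModel q)

/-! ### Components with respect to an elementary model -/

/-- The decomposition of `ℂ((y)) ⊗ M` into the summands of the model. -/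
def decomposition : (DirectSum S.Φ fun φ => S.summand φ) ≃ₗ[Ram q] Ram q ⊗[ConvLaurent] M :=
  letI := Classical.decEq S.Φ
  LinearEquiv.ofBijective (DirectSum.coeLinearMap S.summand)
    (DirectSum.isInternal_submodule_of_iSupIndep_of_iSup_eq_top S.independent S.iSup_eq_top)

/-- The component in the `φ`-summand. -/
def component (φ : S.Φ) : Ram q ⊗[ConvLaurent] M →ₗ[Ram q] S.summand φ :=
  DirectSum.component (Ram q) S.Φ (fun φ => S.summand φ) φ ∘ₗ S.decomposition.symm.toLinearMap

theorem decomposition_of [DecidableEq S.Φ] (φ : S.Φ) (s : S.summand φ) :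
    S.decomposition (DirectSum.of (fun φ => S.summand φ) φ s) = s := by
  have : S.decomposition (DirectSum.of (fun φ => S.summand φ) φ s) =
    (letI := Classical.decEq S.Φ; DirectSum.coeLinearMap S.summand)
      (DirectSum.of (fun φ => S.summand φ) φ s) := rfl
  rw [this]
  convert DirectSum.coeLinearMap_of S.summand φ s

theorem component_coe (φ : S.Φ) (s : S.summand φ) : S.component φ s = s := by
  classical
  change (S.decomposition.symm (s : Ram q ⊗[ConvLaurent] M)) φ = s
  rw [← S.decomposition_of φ s, LinearEquiv.symm_apply_apply, DirectSum.of_eq_same]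

theorem component_coe_ne {φ ψ : S.Φ} (h : φ ≠ ψ) (s : S.summand φ) : S.component ψ s = 0 := by
  classical
  change (S.decomposition.symm (s : Ram q ⊗[ConvLaurent] M)) ψ = 0
  rw [← S.decomposition_of φ s, LinearEquiv.symm_apply_apply, DirectSum.of_eq_of_ne _ _ _ h.symm]

theorem sum_component (n : Ram q ⊗[ConvLaurent] M) :
    ∑ φ, (S.component φ n : Ram q ⊗[ConvLaurent] M) = n := by
  classical
  obtain ⟨d, rfl⟩ := S.decomposition.surjective n
  have h : ∀ φ, S.component φ (S.decomposition d) = d φ := fun φ => by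
    change (S.decomposition.symm _) φ = d φ
    rw [LinearEquiv.symm_apply_apply]
  simp_rw [h]
  conv_rhs => rw [← DirectSum.sum_univ_of d, map_sum]
  exact Finset.sum_congr rfl fun φ _ => (S.decomposition_of φ (d φ)).symm

theorem eq_zero_of_component_eq_zero {n : Ram q ⊗[ConvLaurent] M}
    (h : ∀ φ, S.component φ n = 0) : n = 0 := by
  rw [← S.sum_component n]
  exact Finset.sum_eq_zero fun φ _ => by rw [h φ]; rfl

/-- The operator `y∂_y` of the regular part `R_φ`. -/
abbrev regularEuler (φ : S.Φ) : Module.End ℂ (S.summand φ) :=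
  C.twistedEuler (S.summand φ) (S.stable φ) φ

theorem component_pullbackEuler (φ : S.Φ) (n : Ram q ⊗[ConvLaurent] M) :
    S.component φ (C.pullbackEuler q n) =
      S.regularEuler φ (S.component φ n) + Ram.euler q φ • S.component φ n := by
  have h1 : ∀ ψ, C.pullbackEuler q (S.component ψ n) =
      ((⟨C.pullbackEuler q (S.component ψ n), S.stable ψ _ (S.component ψ n).2⟩ : S.summand ψ) :
        Ram q ⊗[ConvLaurent] M) := fun _ => rfl
  have h2 : S.component φ (C.pullbackEuler q n) =
      ⟨C.pullbackEuler q (S.component φ n), S.stable φ _ (S.component φ n).2⟩ := by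
    conv_lhs => rw [← S.sum_component n, map_sum, map_sum]
    rw [Finset.sum_eq_single φ]
    · exact S.component_coe φ ⟨_, _⟩
    · intro ψ _ hψ
      rw [h1, S.component_coe_ne hψ]
    · simp
  rw [h2]
  ext1
  change _ = (C.pullbackEuler q (S.component φ n) -
    Ram.euler q φ • (S.component φ n : Ram q ⊗[ConvLaurent] M)) + _
  exact (sub_add_cancel _ _).symm

theorem regularEuler_y_smul (φ : S.Φ) (s : S.summand φ) :
    S.regularEuler φ (Ram.y q • s) = Ram.y q • s + Ram.y q • S.regularEuler φ s := by
  ext1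
  change C.pullbackEuler q (Ram.y q • (s : Ram q ⊗[ConvLaurent] M)) -
    Ram.euler q φ • Ram.y q • (s : Ram q ⊗[ConvLaurent] M) =
    Ram.y q • (s : Ram q ⊗[ConvLaurent] M) + Ram.y q • (C.pullbackEuler q s -
      Ram.euler q φ • (s : Ram q ⊗[ConvLaurent] M))
  rw [pullbackEuler_smul, Ram.euler_y, smul_sub, smul_comm (Ram.euler q φ)]
  abel

theorem regularV_spec (φ : S.Φ) :
    IsDeligneFiltration (E := S.summand φ) (formalIntegers q) (Ram.y q) (S.regularEuler φ) (S.regularV φ) ∧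
    ∃ L : Submodule (formalIntegers q) (S.summand φ), L.FG ∧
      ∀ b, ∃ k : ℤ, S.regularV φ b ≤ zpowLattice (E := S.summand φ) (Ram.y q) L k := by
  obtain ⟨L, hfg, hspan, hL⟩ := S.regular φ
  obtain ⟨V, hV, hb⟩ := exists_isDeligneFiltration (L := L) Ram.y_mem Ram.y_ne_zero
    (fun a ha => Ram.exists_eq_add_y_mul ha) (S.regularEuler_y_smul φ) hL hfg
    (exists_mem_zpowLattice hspan)
  have h : S.regularV φ = V := hV.deligne_eq
  rw [h]
  exact ⟨hV, L, hfg, hb⟩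

theorem isDeligneFiltration_regularV (φ : S.Φ) :
    IsDeligneFiltration (E := S.summand φ) (formalIntegers q) (Ram.y q) (S.regularEuler φ) (S.regularV φ) :=
  (S.regularV_spec φ).1

theorem exists_regularV_le (φ : S.Φ) (b : ℝ)
    {W : Submodule (formalIntegers q) (Ram q ⊗[ConvLaurent] M)}
    (hW : ∀ n, ∃ k : ℤ, n ∈ zpowLattice (Ram.y q) W k) :
    ∃ k : ℤ, ∀ s ∈ S.regularV φ b,
      (s : Ram q ⊗[ConvLaurent] M) ∈ zpowLattice (Ram.y q) W k := by
  obtain ⟨L, hfg, hb⟩ := (S.regularV_spec φ).2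
  obtain ⟨k, hk⟩ := hb b
  obtain ⟨l, hl⟩ := exists_map_mem_zpowLattice (E := S.summand φ) hfg (S.summand φ).subtype hW
  refine ⟨l + k, fun s hs => ?_⟩
  have h : Ram.y q ^ (-k) • (s : Ram q ⊗[ConvLaurent] M) ∈ zpowLattice (Ram.y q) W l :=
    hl _ (hk hs)
  rwa [zpow_smul_mem_zpowLattice Ram.y_ne_zero, sub_neg_eq_add] at h

theorem zpow_smul_mem_regularV (φ : S.Φ) {b : ℝ} (k : ℤ) {s : S.summand φ} :
    Ram.y q ^ k • s ∈ S.regularV φ (b + k) ↔ s ∈ S.regularV φ b :=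
  (S.isDeligneFiltration_regularV φ).zpow_smul_mem Ram.y_ne_zero k

/-- The Deligne filtration of a regular part is separated. -/
theorem eq_zero_of_forall_mem_regularV [Module.Finite ConvLaurent M] (φ : S.Φ) (b : ℝ)
    {s : S.summand φ} (h : ∀ k : ℕ, s ∈ S.regularV φ (b + k)) : s = 0 := by
  let B := Module.finBasis ConvLaurent M
  obtain ⟨l, hl⟩ := S.exists_regularV_le φ b (exists_mem_zpowLattice_basisLattice B)
  have key : ∀ k : ℕ, (s : Ram q ⊗[ConvLaurent] M) ∈ zpowLattice (Ram.y q) (basisLattice B q) k := by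
    intro k
    have h1 := h (k - l).toNat
    have h2 : Ram.y q ^ (-((k - l).toNat : ℤ)) • s ∈ S.regularV φ b := by
      rw [← S.zpow_smul_mem_regularV φ ((k - l).toNat : ℤ), smul_smul, ← zpow_add₀ Ram.y_ne_zero,
        add_neg_cancel, zpow_zero, one_smul]
      exact_mod_cast h1
    have h3 := hl _ h2
    rw [Submodule.coe_smul, zpow_smul_mem_zpowLattice Ram.y_ne_zero] at h3
    exact zpowLattice_anti Ram.y_ne_zero Ram.y_mem _
      (by have := Int.self_le_toNat (k - l); omega) h3
  exact Subtype.ext (eq_zero_of_forall_mem_zpowLattice B key)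

/-! ### The formal filtrations -/

theorem mem_formalParabolic {b : ℝ} {n : Ram q ⊗[ConvLaurent] M} :
    n ∈ S.formalParabolic b ↔ ∀ φ, S.component φ n ∈ S.regularV φ b := by
  constructor
  · intro hn φ
    let W : Submodule ℂ (Ram q ⊗[ConvLaurent] M) :=
      (S.regularV φ b).comap ((S.component φ).restrictScalars ℂ)
    suffices S.formalParabolic b ≤ W from this hn
    refine iSup_le fun ψ => ?_
    rintro _ ⟨s, hs, rfl⟩
    change S.component φ s ∈ S.regularV φ b
    by_cases h : ψ = φ
    · subst h
      rwa [component_coe]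
    · rw [S.component_coe_ne h]
      exact zero_mem _
  · intro h
    rw [← S.sum_component n]
    exact sum_mem fun φ _ => Submodule.mem_iSup_of_mem φ ⟨_, h φ, rfl⟩

theorem exists_component_mem (n : Ram q ⊗[ConvLaurent] M) :
    ∃ b, ∀ φ, S.component φ n ∈ S.regularV φ b := by
  choose f hf using fun φ => (S.isDeligneFiltration_regularV φ).exhaustive (S.component φ n)
  obtain ⟨b, hb⟩ := (Set.finite_range f).bddBelow
  exact ⟨b, fun φ => (S.isDeligneFiltration_regularV φ).antitone (hb ⟨φ, rfl⟩) (hf φ)⟩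

theorem formalParabolic_antitone : Antitone S.formalParabolic := fun _ _ h _ hn => by
  rw [mem_formalParabolic] at *
  exact fun φ => (S.isDeligneFiltration_regularV φ).antitone h (hn φ)

theorem smul_mem_formalParabolic {b : ℝ} {a : Ram q} (ha : a ∈ formalIntegers q)
    {n : Ram q ⊗[ConvLaurent] M} (hn : n ∈ S.formalParabolic b) :
    a • n ∈ S.formalParabolic b := by
  rw [mem_formalParabolic] at *
  intro φ
  rw [map_smul]
  exact (S.isDeligneFiltration_regularV φ).smul_mem ha (hn φ)

theorem zpow_smul_mem_formalParabolic {b : ℝ} (k : ℤ) {n : Ram q ⊗[ConvLaurent] M} :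
    Ram.y q ^ k • n ∈ S.formalParabolic (b + k) ↔ n ∈ S.formalParabolic b := by
  simp only [mem_formalParabolic, map_smul, zpow_smul_mem_regularV]

theorem exists_zpow_smul_mem_formalParabolic (b : ℝ) (n : Ram q ⊗[ConvLaurent] M) :
    ∃ k : ℕ, ∀ l : ℤ, (k : ℤ) ≤ l → Ram.y q ^ l • n ∈ S.formalParabolic b := by
  obtain ⟨c, hc⟩ := S.exists_component_mem n
  rw [← mem_formalParabolic] at hc
  obtain ⟨k, hk⟩ := exists_nat_ge (b - c)
  refine ⟨k, fun l hl => S.formalParabolic_antitone ?_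
    ((S.zpow_smul_mem_formalParabolic l).2 hc)⟩
  have : (k : ℝ) ≤ l := by exact_mod_cast hl
  linarith

/-- The filtration `V^b` of `ℂ((y)) ⊗ M`: the Deligne filtration on the regular summand, and
everything on the other ones. -/
def formalV (b : ℝ) : Submodule ℂ (Ram q ⊗[ConvLaurent] M) :=
  ⨅ φ : {φ : S.Φ // (φ : Ram q) = 0},
    (S.regularV φ.1 b).comap ((S.component φ.1).restrictScalars ℂ)

theorem mem_formalV {b : ℝ} {n : Ram q ⊗[ConvLaurent] M} :
    n ∈ S.formalV b ↔ ∀ φ : S.Φ, (φ : Ram q) = 0 → S.component φ n ∈ S.regularV φ b := by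
  simp only [formalV, Submodule.mem_iInf, Subtype.forall]
  rfl

theorem formalParabolic_le_formalV (b : ℝ) : S.formalParabolic b ≤ S.formalV b := fun _ hn =>
  S.mem_formalV.2 fun φ _ => S.mem_formalParabolic.1 hn φ

theorem component_pullbackEuler_of_eq_zero {φ : S.Φ} (h : (φ : Ram q) = 0)
    (n : Ram q ⊗[ConvLaurent] M) :
    S.component φ (C.pullbackEuler q n) = S.regularEuler φ (S.component φ n) := by
  rw [component_pullbackEuler, h, map_zero, zero_smul, add_zero]

theorem pullbackEuler_mem_formalV {b : ℝ} {n : Ram q ⊗[ConvLaurent] M} (hn : n ∈ S.formalV b) :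
    C.pullbackEuler q n ∈ S.formalV b := by
  rw [mem_formalV] at *
  intro φ hφ
  rw [S.component_pullbackEuler_of_eq_zero hφ]
  exact (S.isDeligneFiltration_regularV φ).apply_mem (hn φ hφ)

theorem smul_mem_formalV {b : ℝ} {a : Ram q} (ha : a ∈ formalIntegers q)
    {n : Ram q ⊗[ConvLaurent] M} (hn : n ∈ S.formalV b) : a • n ∈ S.formalV b := by
  rw [mem_formalV] at *
  intro φ hφ
  rw [map_smul]
  exact (S.isDeligneFiltration_regularV φ).smul_mem ha (hn φ hφ)

theorem zpow_smul_mem_formalV {b : ℝ} (k : ℤ) {n : Ram q ⊗[ConvLaurent] M} :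
    Ram.y q ^ k • n ∈ S.formalV (b + k) ↔ n ∈ S.formalV b := by
  simp only [mem_formalV, map_smul, zpow_smul_mem_regularV]

/-- A submodule of `ℂ((y)) ⊗ M` over `ℂ[[y]]⟨y∂_y⟩` that generates it over `ℂ((y))` contains the
irregular part. -/
theorem coe_mem_of_ne_zero {W : Submodule (formalIntegers q) (Ram q ⊗[ConvLaurent] M)}
    (hW : ∀ n, ∃ k : ℤ, n ∈ zpowLattice (Ram.y q) W k)
    (hstab : ∀ n ∈ W, C.pullbackEuler q n ∈ W) {φ : S.Φ} (hφ : (φ : Ram q) ≠ 0)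
    (s : S.summand φ) : (s : Ram q ⊗[ConvLaurent] M) ∈ W := by
  have hV := S.isDeligneFiltration_regularV φ
  obtain ⟨g, hg, hgφ⟩ := (S.polar φ φ.2).exists_mul_euler hφ
  obtain ⟨k, hk⟩ := S.exists_regularV_le φ 0 hW
  have key : ∀ (j : ℕ), ∀ s ∈ S.regularV φ 0,
      Ram.y q ^ (-k - j : ℤ) • (s : Ram q ⊗[ConvLaurent] M) ∈ W := by
    intro j
    induction j with
    | zero =>
      intro s hs
      simpa [mem_zpowLattice] using hk s hs
    | succ j ih =>
      intro s hs
      have h1 : ∀ s' : S.summand φ, C.pullbackEuler q s' = S.regularEuler φ s' +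
          Ram.euler q φ • (s' : Ram q ⊗[ConvLaurent] M) := fun s' =>
        (sub_add_cancel _ _).symm
      have h2 := hstab _ (ih s hs)
      rw [euler_zpow_smul Ram.y_ne_zero (fun n => by
        rw [C.pullbackEuler_smul, Ram.euler_y]), h1, smul_add, smul_add,
        smul_comm _ ((-k - j : ℤ) : ℂ), add_right_comm] at h2
      have h3 : ((-k - j : ℤ) : ℂ) • Ram.y q ^ (-k - j : ℤ) • (s : Ram q ⊗[ConvLaurent] M) ∈ W := by
        rw [← algebraMap_smul (formalIntegers q)]
        exact W.smul_mem _ (ih s hs)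
      have h4 := (Submodule.add_mem_iff_right W (add_mem (ih _ (hV.apply_mem hs)) h3)).1 h2
      have h5 := W.smul_mem (⟨g, hg⟩ : formalIntegers q) h4
      change g • Ram.y q ^ (-k - j : ℤ) • Ram.euler q φ • (s : Ram q ⊗[ConvLaurent] M) ∈ W at h5
      rw [smul_comm (Ram.y q ^ (-k - j : ℤ)), smul_smul, hgφ, smul_smul, ← zpow_neg_one,
        ← zpow_add₀ Ram.y_ne_zero] at h5
      convert h5 using 3
      push_cast
      ring
  obtain ⟨b, hb⟩ := hV.exhaustive s
  obtain ⟨j, hj⟩ := exists_nat_ge (-b)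
  obtain ⟨l, hl⟩ : ∃ l : ℕ, (j : ℤ) - k ≤ l := ⟨(j - k).toNat, Int.self_le_toNat _⟩
  have h1 : Ram.y q ^ (k + l : ℤ) • s ∈ S.regularV φ 0 := by
    refine hV.antitone ?_ ((S.zpow_smul_mem_regularV φ (k + l)).2 hb)
    have : (j : ℝ) ≤ ((k + l : ℤ) : ℝ) := by exact_mod_cast (by omega : (j : ℤ) ≤ k + l)
    linarith
  have h2 := key l _ h1
  rw [Submodule.coe_smul, smul_smul, ← zpow_add₀ Ram.y_ne_zero] at h2
  simpa using h2

/-- A bounded subset of `ℂ((y)) ⊗ M` stable by `y∂_y` is contained in the regular part. -/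
theorem component_eq_zero_of_bounded [Module.Finite ConvLaurent M]
    {X : Set (Ram q ⊗[ConvLaurent] M)} (hX : ∀ n ∈ X, C.pullbackEuler q n ∈ X) {φ : S.Φ}
    (hφ : (φ : Ram q) ≠ 0) {b : ℝ} (hb : ∀ n ∈ X, S.component φ n ∈ S.regularV φ b)
    {n : Ram q ⊗[ConvLaurent] M} (hn : n ∈ X) : S.component φ n = 0 := by
  have hV := S.isDeligneFiltration_regularV φ
  obtain ⟨g, hg, hgφ⟩ := (S.polar φ φ.2).exists_mul_euler hφ
  have key : ∀ (j : ℕ), ∀ n ∈ X, S.component φ n ∈ S.regularV φ (b + j) := by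
    intro j
    induction j with
    | zero => simpa using hb
    | succ j ih =>
      intro n hn
      have h1 := ih _ (hX n hn)
      rw [component_pullbackEuler] at h1
      have h2 := (Submodule.add_mem_iff_right (M := S.summand φ) _ (hV.apply_mem (ih n hn))).1 h1
      have h3 := hV.smul_mem hg h2
      rw [smul_smul, hgφ, ← zpow_neg_one, ← S.zpow_smul_mem_regularV φ 1, smul_smul,
        ← zpow_add₀ Ram.y_ne_zero] at h3
      simpa [add_assoc] using h3
  exact S.eq_zero_of_forall_mem_regularV φ b fun k => key k n hn

end ElementaryModel

end Connection

/-- The quotient `V / W` is finite dimensional if it embeds in a finite dimensional one. -/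
theorem finite_quotient_of_map {E E' : Type*} [AddCommGroup E] [Module ℂ E] [AddCommGroup E']
    [Module ℂ E'] {V W : Submodule ℂ E} {V' W' : Submodule ℂ E'} (f : E →ₗ[ℂ] E')
    (hV : ∀ m ∈ V, f m ∈ V') (hW : ∀ m ∈ V, m ∈ W ↔ f m ∈ W')
    (h : Module.Finite ℂ (V' ⧸ W'.submoduleOf V')) : Module.Finite ℂ (V ⧸ W.submoduleOf V) := by
  let g : V →ₗ[ℂ] V' ⧸ W'.submoduleOf V' := (W'.submoduleOf V').mkQ ∘ₗ f.restrict hV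
  have hg : LinearMap.ker g = W.submoduleOf V := by
    ext m
    change Submodule.Quotient.mk _ = 0 ↔ (m : E) ∈ W
    rw [Submodule.Quotient.mk_eq_zero, hW m m.2]
    rfl
  rw [← hg]
  exact Module.Finite.equiv g.quotKerEquivRange.symm

namespace Connection

section Extension

variable {M : Type*} [AddCommGroup M] [Module ℂ M] [Module ConvLaurent M]
  [IsScalarTower ℂ ConvLaurent M] (C : Connection M) {q : ℕ+} {U : Submodule ℂ M}

/-- The `ℂ[[y]]`-submodule of `ℂ((y)) ⊗ M` generated by a subspace of `M`. -/
def formalSpan (q : ℕ+) (U : Submodule ℂ M) :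
    Submodule (formalIntegers q) (Ram q ⊗[ConvLaurent] M) :=
  Submodule.span (formalIntegers q) (unitMap q M '' U)

theorem unitMap_mem_formalSpan {m : M} (hm : m ∈ U) : unitMap q M m ∈ formalSpan q U :=
  Submodule.subset_span ⟨m, hm, rfl⟩

theorem pullbackEuler_mem_formalSpan (hU : ∀ m ∈ U, C.euler m ∈ U)
    {n : Ram q ⊗[ConvLaurent] M} (hn : n ∈ formalSpan q U) :
    C.pullbackEuler q n ∈ formalSpan q U := by
  induction hn using Submodule.span_induction with
  | mem x hx =>
    obtain ⟨m, hm, rfl⟩ := hx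
    rw [pullbackEuler_unitMap, ← algebraMap_smul (formalIntegers q)]
    exact Submodule.smul_mem _ _ (unitMap_mem_formalSpan (hU m hm))
  | zero => rw [map_zero]; exact zero_mem _
  | add x y _ _ hx hy => rw [map_add]; exact add_mem hx hy
  | smul a x hx' hx =>
    change C.pullbackEuler q ((a : Ram q) • x) ∈ _
    rw [pullbackEuler_smul]
    exact add_mem
      (Submodule.smul_mem _ (⟨_, Ram.euler_mem a.2⟩ : formalIntegers q) hx')
      (Submodule.smul_mem _ a hx)

theorem exists_mem_zpowLattice_formalSpan (hU : ∀ m, ∃ k : ℤ, ConvLaurent.x ^ k • m ∈ U)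
    (n : Ram q ⊗[ConvLaurent] M) :
    ∃ k : ℤ, n ∈ zpowLattice (Ram.y q) (formalSpan q U) k := by
  refine exists_mem_zpowLattice (eq_top_iff.2 fun n _ => ?_) n
  induction n using TensorProduct.induction_on with
  | zero => exact zero_mem _
  | tmul g m =>
    obtain ⟨k, hk⟩ := hU m
    have h := Submodule.subset_span (R := Ram q) (unitMap_mem_formalSpan (q := q) hk)
    rw [unitMap_x_zpow_smul] at h
    have h2 := Submodule.smul_mem _ (g * Ram.y q ^ (-((q : ℕ) * k) : ℤ)) h
    rw [smul_smul, mul_assoc, ← zpow_add₀ Ram.y_ne_zero, neg_add_cancel, zpow_zero, mul_one] at h2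
    have h3 : g • unitMap q M m = g ⊗ₜ m := by
      change g • (1 ⊗ₜ m) = _
      rw [TensorProduct.smul_tmul', smul_eq_mul, mul_one]
    rwa [h3] at h2
  | add a b ha hb => exact add_mem (ha trivial) (hb trivial)

theorem invariantProj_mem_formalSpan {n : Ram q ⊗[ConvLaurent] M} (hn : n ∈ formalSpan q U) :
    invariantProj q M n ∈ formalSpan q U := by
  suffices ∀ g ∈ formalIntegers q, invariantProj q M (g • n) ∈ formalSpan q U by
    simpa using this 1 (one_mem _)
  induction hn using Submodule.span_induction with
  | mem x hx =>
    obtain ⟨m, hm, rfl⟩ := hx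
    intro g hg
    rw [invariantProj_smul_unitMap]
    exact Submodule.smul_mem _ (⟨_, Ram.proj_mem hg⟩ : formalIntegers q)
      (unitMap_mem_formalSpan hm)
  | zero => intro g _; rw [smul_zero, map_zero]; exact zero_mem _
  | add x y _ _ hx hy =>
    intro g hg
    rw [smul_add, map_add]
    exact add_mem (hx g hg) (hy g hg)
  | smul a x _ hx =>
    intro g hg
    change invariantProj q M (g • (a : Ram q) • x) ∈ _
    rw [smul_smul]
    exact hx _ (mul_mem hg a.2)

end Extension

namespace ElementaryModel

variable {M : Type*} [AddCommGroup M] [Module ℂ M] [Module ConvLaurent M]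
  [IsScalarTower ℂ ConvLaurent M] {C : Connection M} {q : ℕ+} (S : C.ElementaryModel q)

/-- Approximation of the invariant part of `ℂ[[y]] · U` by `U`. -/
theorem exists_invariantProj_sub_mem {U : Submodule ℂ M}
    (hU : ∀ a ∈ convIntegers, ∀ m ∈ U, a • m ∈ U) (b : ℝ) {n : Ram q ⊗[ConvLaurent] M}
    (hn : n ∈ formalSpan q U) :
    ∃ u ∈ U, invariantProj q M n - unitMap q M u ∈ S.formalParabolic b := by
  suffices ∀ g ∈ formalIntegers q,
      ∃ u ∈ U, invariantProj q M (g • n) - unitMap q M u ∈ S.formalParabolic b by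
    simpa using this 1 (one_mem _)
  induction hn using Submodule.span_induction with
  | mem x hx =>
    obtain ⟨m, hm, rfl⟩ := hx
    intro g hg
    obtain ⟨k, hk⟩ := S.exists_zpow_smul_mem_formalParabolic b (unitMap q M m)
    obtain ⟨a, ha, hag⟩ := Ram.exists_proj_sub_mem hg k
    refine ⟨a • m, hU a ha m hm, ?_⟩
    rw [invariantProj_smul_unitMap, unitMap_smul]
    have h1 : (k : ℤ) ≤ (q : ℕ) * k :=
      le_mul_of_one_le_left (Int.natCast_nonneg k) (by exact_mod_cast q.pos)
    have h2 := S.smul_mem_formalParabolic hag (hk _ h1)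
    rw [smul_smul, mul_comm, ← mul_assoc, ← zpow_add₀ Ram.y_ne_zero, add_neg_cancel, zpow_zero,
      one_mul] at h2
    convert h2 using 1
    exact (sub_smul (Ram.proj q g) (algebraMap ConvLaurent (Ram q) a) (unitMap q M m)).symm
  | zero => exact fun g _ => ⟨0, zero_mem _, by simp⟩
  | add x y _ _ hx hy =>
    intro g hg
    obtain ⟨u, hu, hxu⟩ := hx g hg
    obtain ⟨v, hv, hyv⟩ := hy g hg
    refine ⟨u + v, add_mem hu hv, ?_⟩
    rw [smul_add, map_add, map_add, add_sub_add_comm]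
    exact add_mem hxu hyv
  | smul a x _ hx =>
    intro g hg
    obtain ⟨u, hu, hxu⟩ := hx _ (mul_mem hg a.2)
    refine ⟨u, hu, ?_⟩
    change invariantProj q M (g • (a : Ram q) • x) - _ ∈ _
    rwa [smul_smul]

/-- The projection on the regular summand. -/
def regularProj : Ram q ⊗[ConvLaurent] M →ₗ[Ram q] Ram q ⊗[ConvLaurent] M :=
  open Classical in
  ∑ φ : S.Φ, if (φ : Ram q) = 0 then (S.summand φ).subtype ∘ₗ S.component φ else 0

theorem component_regularProj (φ : S.Φ) (n : Ram q ⊗[ConvLaurent] M) [Decidable ((φ : Ram q) = 0)] :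
    S.component φ (S.regularProj n) = if (φ : Ram q) = 0 then S.component φ n else 0 := by
  classical
  rw [regularProj, LinearMap.sum_apply, map_sum, Finset.sum_eq_single φ]
  · split_ifs
    · exact S.component_coe φ _
    · rw [LinearMap.zero_apply, map_zero]
  · intro ψ _ hψ
    split_ifs
    · exact S.component_coe_ne hψ _
    · rw [LinearMap.zero_apply, map_zero]
  · simp

theorem mem_formalSpan_of_component_eq_zero {U : Submodule ℂ M} (hθ : ∀ m ∈ U, C.euler m ∈ U)
    (hU : ∀ m, ∃ k : ℤ, ConvLaurent.x ^ k • m ∈ U) {n : Ram q ⊗[ConvLaurent] M}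
    (hn : ∀ φ : S.Φ, (φ : Ram q) = 0 → S.component φ n = 0) : n ∈ formalSpan q U := by
  rw [← S.sum_component n]
  refine sum_mem fun φ _ => ?_
  by_cases hφ : (φ : Ram q) = 0
  · rw [hn φ hφ]
    exact zero_mem _
  · exact S.coe_mem_of_ne_zero (exists_mem_zpowLattice_formalSpan hU)
      (fun n hn => C.pullbackEuler_mem_formalSpan hθ hn) hφ _

variable [Module.Finite ConvLaurent M]

theorem exists_formalParabolic_le_basisLattice {ι : Type*} [Finite ι] (B : Module.Basis ι ConvLaurent M)
    (b : ℝ) : ∃ k : ℤ, ∀ n ∈ S.formalParabolic b,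
      n ∈ zpowLattice (Ram.y q) (basisLattice B q) ((q : ℕ) * k) := by
  choose f hf using fun φ => S.exists_regularV_le φ b (exists_mem_zpowLattice_basisLattice B)
  obtain ⟨k, hk⟩ := (Set.finite_range f).bddBelow
  refine ⟨-(k.natAbs : ℤ), fun n hn => ?_⟩
  rw [mem_formalParabolic] at hn
  rw [← S.sum_component n]
  refine sum_mem fun φ _ => zpowLattice_anti Ram.y_ne_zero Ram.y_mem _ ?_ (hf φ _ (hn φ))
  have h1 : (k.natAbs : ℤ) ≤ (q : ℕ) * k.natAbs :=
    le_mul_of_one_le_left (Int.natCast_nonneg _) (by exact_mod_cast q.pos)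
  have h2 := hk ⟨φ, rfl⟩
  rw [mul_neg]
  omega

theorem exists_basisLattice_le_formalParabolic {ι : Type*} [Finite ι]
    (B : Module.Basis ι ConvLaurent M) (k : ℤ) : ∃ b : ℝ, ∀ n,
      n ∈ zpowLattice (Ram.y q) (basisLattice B q) k → n ∈ S.formalParabolic b := by
  have := Fintype.ofFinite ι
  choose f hf using fun i => S.exists_component_mem (B.baseChange (Ram q) i)
  obtain ⟨b, hb⟩ := (Set.finite_range f).bddBelow
  refine ⟨b + k, fun n hn => ?_⟩
  rw [mem_zpowLattice, mem_basisLattice] at hn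
  have h : Ram.y q ^ (-k) • n ∈ S.formalParabolic b := by
    rw [← (B.baseChange (Ram q)).sum_repr (Ram.y q ^ (-k) • n)]
    exact sum_mem fun i _ => S.smul_mem_formalParabolic (hn i)
      (S.formalParabolic_antitone (hb ⟨i, rfl⟩) (S.mem_formalParabolic.2 (hf i)))
  rw [← S.zpow_smul_mem_formalParabolic k, smul_smul, ← zpow_add₀ Ram.y_ne_zero] at h
  simpa using h

/-- The projection `e ⊗ 1` preserves the regular part. -/
theorem component_invariantProj_eq_zero {n : Ram q ⊗[ConvLaurent] M}
    (hn : ∀ φ : S.Φ, (φ : Ram q) ≠ 0 → S.component φ n = 0) {φ : S.Φ} (hφ : (φ : Ram q) ≠ 0) :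
    S.component φ (invariantProj q M n) = 0 := by
  obtain ⟨b, hb⟩ := S.exists_component_mem n
  let B := Module.finBasis ConvLaurent M
  obtain ⟨k, hk⟩ := S.exists_formalParabolic_le_basisLattice B b
  obtain ⟨c, hc⟩ := S.exists_basisLattice_le_formalParabolic B ((q : ℕ) * k)
  let X : Set (Ram q ⊗[ConvLaurent] M) := invariantProj q M '' {n | n ∈ S.formalParabolic b ∧
    ∀ φ : S.Φ, (φ : Ram q) ≠ 0 → S.component φ n = 0}
  refine S.component_eq_zero_of_bounded (X := X) ?_ hφ (b := c) ?_
    ⟨n, ⟨S.mem_formalParabolic.2 hb, hn⟩, rfl⟩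
  · rintro _ ⟨n, ⟨h1, h2⟩, rfl⟩
    refine ⟨C.pullbackEuler q n, ⟨?_, fun ψ hψ => ?_⟩, C.invariantProj_pullbackEuler n⟩
    · rw [mem_formalParabolic] at h1 ⊢
      intro ψ
      by_cases hψ : (ψ : Ram q) = 0
      · rw [S.component_pullbackEuler_of_eq_zero hψ]
        exact (S.isDeligneFiltration_regularV ψ).apply_mem (h1 ψ)
      · rw [component_pullbackEuler, h2 ψ hψ, map_zero, smul_zero, add_zero]
        exact zero_mem _
    · rw [component_pullbackEuler, h2 ψ hψ, map_zero, smul_zero, add_zero]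
  · rintro _ ⟨n, ⟨h1, -⟩, rfl⟩
    exact S.mem_formalParabolic.1 (hc _ (invariantProj_mem_zpowLattice B (hk n h1))) φ

/-- The projection `e ⊗ 1` preserves the irregular part. -/
theorem component_invariantProj_eq_zero_of_irregular {U : Submodule ℂ M}
    (hθ : ∀ m ∈ U, C.euler m ∈ U) (hU : ∀ m, ∃ k : ℤ, ConvLaurent.x ^ k • m ∈ U) {b : ℝ}
    (hUV : ∀ m ∈ U, unitMap q M m ∈ S.formalV b) {n : Ram q ⊗[ConvLaurent] M}
    (hn : ∀ φ : S.Φ, (φ : Ram q) = 0 → S.component φ n = 0) {φ : S.Φ} (hφ : (φ : Ram q) = 0) :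
    S.component φ (invariantProj q M n) = 0 := by
  have hle : ∀ n ∈ formalSpan q U, n ∈ S.formalV b := by
    intro n hn
    induction hn using Submodule.span_induction with
    | mem x hx =>
      obtain ⟨m, hm, rfl⟩ := hx
      exact hUV m hm
    | zero => exact zero_mem _
    | add x y _ _ hx hy => exact add_mem hx hy
    | smul a x _ hx => exact S.smul_mem_formalV a.2 hx
  refine S.eq_zero_of_forall_mem_regularV φ b fun k => ?_
  have h1 : Ram.y q ^ ((q : ℕ) * (-k) : ℤ) • n ∈ formalSpan q U :=
    S.mem_formalSpan_of_component_eq_zero hθ hU fun ψ hψ => by rw [map_smul, hn ψ hψ, smul_zero]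
  have h2 := hle _ (invariantProj_mem_formalSpan h1)
  rw [invariantProj_zpow_smul, ← S.zpow_smul_mem_formalV ((q : ℕ) * k), smul_smul,
    ← zpow_add₀ Ram.y_ne_zero, mul_neg, add_neg_cancel, zpow_zero, one_smul, mem_formalV] at h2
  refine (S.isDeligneFiltration_regularV φ).antitone ?_ (h2 φ hφ)
  have h3 : (1 : ℝ) ≤ (q : ℕ) := by exact_mod_cast q.pos
  have h4 := mul_le_mul_of_nonneg_right h3 (Nat.cast_nonneg (α := ℝ) k)
  push_cast
  linarith

theorem mem_parabolic {b : ℝ} {m : M} :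
    m ∈ S.parabolic b ↔ unitMap q M m ∈ S.formalParabolic (q * b) := Iff.rfl

theorem smul_mem_parabolic {b : ℝ} {a : ConvLaurent} (ha : a ∈ convIntegers) {m : M}
    (hm : m ∈ S.parabolic b) : a • m ∈ S.parabolic b := by
  rw [mem_parabolic] at *
  rw [unitMap_smul]
  exact S.smul_mem_formalParabolic (algebraMap_mem_formalIntegers.2 ha) hm

theorem exists_zpow_smul_mem_parabolic (b : ℝ) (m : M) :
    ∃ k : ℤ, ConvLaurent.x ^ k • m ∈ S.parabolic b := by
  obtain ⟨k, hk⟩ := S.exists_zpow_smul_mem_formalParabolic (q * b) (unitMap q M m)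
  refine ⟨k, ?_⟩
  rw [mem_parabolic, unitMap_x_zpow_smul]
  exact hk _ (le_mul_of_one_le_left (Int.natCast_nonneg k) (by exact_mod_cast q.pos))

/-- The elements of `M` whose regular part belongs to `V^{qb}`. -/
def meromorphicV (b : ℝ) : Submodule ℂ M :=
  (S.formalV (q * b)).comap ((unitMap q M).restrictScalars ℂ)

theorem mem_meromorphicV {b : ℝ} {m : M} :
    m ∈ S.meromorphicV b ↔ unitMap q M m ∈ S.formalV (q * b) := Iff.rfl

theorem euler_mem_meromorphicV {b : ℝ} {m : M} (hm : m ∈ S.meromorphicV b) :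
    C.euler m ∈ S.meromorphicV b := by
  rw [mem_meromorphicV] at *
  have h := S.pullbackEuler_mem_formalV hm
  rw [pullbackEuler_unitMap] at h
  exact ((S.formalV (q * b)).smul_mem_iff (by exact_mod_cast q.ne_zero)).1 h

theorem generated_parabolic (b : ℝ) :
    generated convIntegers C.euler (S.parabolic b : Set M) = S.meromorphicV b := by
  set U := generated convIntegers C.euler (S.parabolic b : Set M) with hUdef
  have hUV : U ≤ S.meromorphicV b := by
    refine generated_le (fun m hm => S.formalParabolic_le_formalV _ hm) (fun a ha m hm => ?_)
      (fun m => S.euler_mem_meromorphicV)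
    rw [mem_meromorphicV] at *
    rw [unitMap_smul]
    exact S.smul_mem_formalV (algebraMap_mem_formalIntegers.2 ha) hm
  refine le_antisymm hUV fun m hm => ?_
  have hθ : ∀ m ∈ U, C.euler m ∈ U := fun m hm => apply_mem_generated hm
  have hA : ∀ a ∈ convIntegers, ∀ m ∈ U, a • m ∈ U := fun a ha m hm => smul_mem_generated ha hm
  have hU : ∀ m, ∃ k : ℤ, ConvLaurent.x ^ k • m ∈ U := fun m =>
    (S.exists_zpow_smul_mem_parabolic b m).imp fun k hk => subset_generated _ _ hk
  classical
  set p := S.regularProj (unitMap q M m) with hp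
  set n := unitMap q M m - p with hn
  have hp0 : ∀ φ : S.Φ, (φ : Ram q) ≠ 0 → S.component φ p = 0 := fun φ hφ => by
    rw [hp, component_regularProj, if_neg hφ]
  have hn0 : ∀ φ : S.Φ, (φ : Ram q) = 0 → S.component φ n = 0 := fun φ hφ => by
    rw [hn, map_sub, hp, component_regularProj, if_pos hφ, sub_self]
  have hen : invariantProj q M n = n := by
    have h1 : invariantProj q M n - n = p - invariantProj q M p := by
      rw [hn, map_sub, invariantProj_unitMap]
      abel
    rw [← sub_eq_zero]
    refine S.eq_zero_of_component_eq_zero fun φ => ?_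
    by_cases hφ : (φ : Ram q) = 0
    · rw [map_sub, hn0 φ hφ,
        S.component_invariantProj_eq_zero_of_irregular hθ hU (fun m hm => hUV hm) hn0 hφ]
      exact sub_self (0 : S.summand φ)
    · rw [h1, map_sub, hp0 φ hφ, S.component_invariantProj_eq_zero hp0 hφ]
      exact sub_self (0 : S.summand φ)
  obtain ⟨u, hu, hnu⟩ := S.exists_invariantProj_sub_mem hA (q * b)
    (S.mem_formalSpan_of_component_eq_zero hθ hU hn0)
  rw [hen] at hnu
  have hpP : p ∈ S.formalParabolic (q * b) := by
    rw [mem_formalParabolic]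
    intro φ
    rw [hp, component_regularProj]
    split_ifs with hφ
    · exact S.mem_formalV.1 hm φ hφ
    · exact zero_mem _
  have hmu : m - u ∈ S.parabolic b := by
    rw [mem_parabolic, map_sub]
    have : unitMap q M m - unitMap q M u = p + (n - unitMap q M u) := by rw [hn]; abel
    rw [this]
    exact add_mem hpP hnu
  have := add_mem (subset_generated (A := convIntegers) C.euler _ hmu : m - u ∈ U) hu
  rwa [sub_add_cancel] at this

theorem exists_parabolic_eq_span (b : ℝ) :
    ∃ T : Finset M, ∀ m, m ∈ S.parabolic b ↔ m ∈ Submodule.span convIntegers (T : Set M) := by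
  let B := Module.finBasis ConvLaurent M
  obtain ⟨k, hk⟩ := S.exists_formalParabolic_le_basisLattice B (q * b)
  let G : Submodule convIntegers M :=
    { toAddSubmonoid := (S.parabolic b).toAddSubmonoid
      smul_mem' := fun a m hm => S.smul_mem_parabolic a.2 hm }
  let f : M →ₗ[convIntegers] M :=
    { toFun := fun m => ConvLaurent.x ^ (-k) • m
      map_add' := smul_add _
      map_smul' := fun a m => smul_comm (ConvLaurent.x ^ (-k)) (a : ConvLaurent) m }
  have hf : Function.Injective f := fun m n h =>
    smul_right_injective M (zpow_ne_zero _ ConvLaurent.x_ne_zero) h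
  have hle : G.map f ≤ Submodule.span convIntegers (Set.range B) := by
    rintro _ ⟨m, hm, rfl⟩
    have h1 : unitMap q M m ∈ _ := hk _ hm
    rw [mem_zpowLattice, ← mul_neg] at h1
    change ConvLaurent.x ^ (-k) • m ∈ _
    have h2 : ∀ i, B.repr (ConvLaurent.x ^ (-k) • m) i ∈ convIntegers := fun i => by
      rw [← algebraMap_mem_formalIntegers (q := q)]
      have h3 := h1 i
      rw [← unitMap_x_zpow_smul] at h3
      change (B.baseChange (Ram q)).repr (1 ⊗ₜ _) i ∈ _ at h3
      rwa [Module.Basis.baseChange_repr_tmul, ← Algebra.algebraMap_eq_smul_one] at h3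
    rw [← B.sum_repr (ConvLaurent.x ^ (-k) • m)]
    exact sum_mem fun i _ => Submodule.smul_mem _ (⟨_, h2 i⟩ : convIntegers)
      (Submodule.subset_span ⟨i, rfl⟩)
  have hnoeth : IsNoetherian convIntegers (Submodule.span convIntegers (Set.range B)) :=
    isNoetherian_of_fg_of_noetherian _ (Submodule.fg_span (Set.finite_range B))
  obtain ⟨T, hT⟩ :=
    Submodule.fg_of_fg_map_injective f hf (isNoetherian_submodule.1 hnoeth _ hle)
  exact ⟨T, fun m => by rw [hT]; rfl⟩

theorem meromorphicV_antitone : Antitone S.meromorphicV := fun b c hbc m hm => by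
  rw [mem_meromorphicV, mem_formalV] at *
  have hq : (0 : ℝ) ≤ (q : ℕ) := Nat.cast_nonneg _
  exact fun φ hφ => (S.isDeligneFiltration_regularV φ).antitone (by gcongr) (hm φ hφ)

theorem mem_meromorphicV_iff {φ : S.Φ} (hφ : (φ : Ram q) = 0) {b : ℝ} {m : M} :
    m ∈ S.meromorphicV b ↔ S.component φ (unitMap q M m) ∈ S.regularV φ (q * b) := by
  rw [mem_meromorphicV, mem_formalV]
  refine ⟨fun h => h φ hφ, fun h ψ hψ => ?_⟩
  obtain rfl : ψ = φ := Subtype.ext (hψ.trans hφ.symm)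
  exact h

theorem mem_above_meromorphicV_iff {φ : S.Φ} (hφ : (φ : Ram q) = 0) {b : ℝ} {m : M} :
    m ∈ above S.meromorphicV b ↔
      S.component φ (unitMap q M m) ∈ above (E := S.summand φ) (S.regularV φ) (q * b) := by
  have hq : (0 : ℝ) < (q : ℕ) := by exact_mod_cast q.pos
  rw [mem_above S.meromorphicV_antitone,
    mem_above (E := S.summand φ) (S.isDeligneFiltration_regularV φ).antitone]
  constructor
  · rintro ⟨c, hc, h⟩
    exact ⟨q * c, by gcongr, (S.mem_meromorphicV_iff hφ).1 h⟩
  · rintro ⟨c, hc, h⟩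
    refine ⟨c / (q : ℕ), by rwa [lt_div_iff₀ hq, mul_comm], (S.mem_meromorphicV_iff hφ).2 ?_⟩
    rwa [mul_div_cancel₀ _ hq.ne']

theorem component_unitMap_euler {φ : S.Φ} (hφ : (φ : Ram q) = 0) (m : M) :
    ((q : ℕ) : ℂ) • S.component φ (unitMap q M (C.euler m)) =
      S.regularEuler φ (S.component φ (unitMap q M m)) := by
  rw [← S.component_pullbackEuler_of_eq_zero hφ, pullbackEuler_unitMap]
  exact (map_smul ((S.component φ).restrictScalars ℂ) _ _).symm

theorem isDeligneFiltration_meromorphicV :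
    IsDeligneFiltration convIntegers ConvLaurent.x C.euler S.meromorphicV := by
  have hq : (0 : ℝ) < (q : ℕ) := by exact_mod_cast q.pos
  have hx : ∀ (b : ℝ) (m : M),
      ConvLaurent.x • m ∈ S.meromorphicV (b + 1) ↔ m ∈ S.meromorphicV b := by
    intro b m
    have h := unitMap_x_zpow_smul (q := q) 1 m
    rw [zpow_one] at h
    rw [mem_meromorphicV, mem_meromorphicV, h, ← S.zpow_smul_mem_formalV ((q : ℕ) * 1) (b := q * b)]
    push_cast
    rw [mul_add]
  have hcases : (∃ φ : S.Φ, (φ : Ram q) = 0) ∨ ∀ b, S.meromorphicV b = ⊤ := by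
    by_cases h : ∃ φ : S.Φ, (φ : Ram q) = 0
    · exact Or.inl h
    · refine Or.inr fun b => eq_top_iff.2 fun m _ => ?_
      rw [mem_meromorphicV, mem_formalV]
      exact fun φ hφ => absurd ⟨φ, hφ⟩ h
  have habove : (∀ b, S.meromorphicV b = ⊤) → ∀ b, above S.meromorphicV b = ⊤ := fun h b =>
    eq_top_iff.2 fun m _ => (mem_above S.meromorphicV_antitone).2
      ⟨b + 1, by linarith, by rw [h]; trivial⟩
  refine ⟨S.meromorphicV_antitone, fun m => ?_, fun b => ?_, fun b m => ?_, ?_, fun b => ?_,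
    fun b m hm hna β hβ => ?_⟩
  · obtain ⟨b, hb⟩ := S.exists_component_mem (unitMap q M m)
    refine ⟨b / (q : ℕ), ?_⟩
    rw [mem_meromorphicV, mul_div_cancel₀ _ hq.ne', mem_formalV]
    exact fun φ _ => hb φ
  · obtain ⟨T, hT⟩ := S.exists_parabolic_eq_span b
    refine ⟨T, ?_⟩
    rw [← S.generated_parabolic b]
    refine le_antisymm (generated_le (fun m hm => ?_) (fun a ha m hm => smul_mem_generated ha hm)
      (fun m hm => apply_mem_generated hm))
      (generated_mono fun m hm => (hT m).2 (Submodule.subset_span hm))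
    have hm' := (hT m).1 hm
    induction hm' using Submodule.span_induction with
    | mem x hx => exact subset_generated _ _ hx
    | zero => exact zero_mem _
    | add x y hx' hy' hx hy => exact add_mem (hx ((hT x).2 hx')) (hy ((hT y).2 hy'))
    | smul a x hx' hx => exact smul_mem_generated a.2 (hx ((hT x).2 hx'))
  · constructor
    · intro hm
      have h : ConvLaurent.x • ConvLaurent.x⁻¹ • m = m := by
        rw [smul_smul, mul_inv_cancel₀ ConvLaurent.x_ne_zero, one_smul]
      exact ⟨ConvLaurent.x⁻¹ • m, (hx b _).1 (by rwa [h]), h.symm⟩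
    · rintro ⟨n, hn, rfl⟩
      exact (hx b n).2 hn
  · rcases hcases with ⟨φ, hφ⟩ | h
    · obtain ⟨J, hJ⟩ := (S.isDeligneFiltration_regularV φ).discrete
      refine ⟨(J ×ˢ Finset.range q).image fun p => (p.1 + p.2) / (q : ℕ), fun b c hbc hbcJ => ?_⟩
      have h : S.regularV φ (q * b) = S.regularV φ (q * c) := by
        refine hJ _ _ (by gcongr) fun a ha k hk => ?_
        have hk1 : (k : ℝ) = ((k % (q : ℕ)).toNat : ℝ) + (q : ℕ) * ((k / (q : ℕ) : ℤ) : ℝ) := by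
          have h1 := Int.emod_nonneg k (by exact_mod_cast q.ne_zero : ((q : ℕ) : ℤ) ≠ 0)
          have h2 : ((k % (q : ℕ)).toNat : ℤ) + (q : ℕ) * (k / (q : ℕ)) = k := by
            rw [Int.toNat_of_nonneg h1, Int.emod_add_mul_ediv]
          exact_mod_cast h2.symm
        have h2 : (k % (q : ℕ)).toNat < (q : ℕ) := by
          have := Int.emod_lt_of_pos k (by exact_mod_cast q.pos : (0 : ℤ) < (q : ℕ))
          have := Int.emod_nonneg k (by exact_mod_cast q.ne_zero : ((q : ℕ) : ℤ) ≠ 0)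
          omega
        refine hbcJ _ (Finset.mem_image.2 ⟨(a, (k % (q : ℕ)).toNat),
          Finset.mem_product.2 ⟨ha, Finset.mem_range.2 h2⟩, rfl⟩) (k / (q : ℕ)) ?_
        have h3 : (a + ((k % (q : ℕ)).toNat : ℝ)) / (q : ℕ) + ((k / (q : ℕ) : ℤ) : ℝ) =
            (a + k) / (q : ℕ) := by
          rw [hk1]
          field_simp
          ring
        simp only
        rw [h3]
        refine ⟨?_, ?_⟩
        · rw [le_div_iff₀ hq, mul_comm]
          exact hk.1
        · rw [div_lt_iff₀ hq, mul_comm c]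
          exact hk.2
      ext m
      rw [S.mem_meromorphicV_iff hφ, S.mem_meromorphicV_iff hφ, h]
    · exact ⟨∅, fun b c _ _ => by rw [h, h]⟩
  · rcases hcases with ⟨φ, hφ⟩ | h
    · exact finite_quotient_of_map (E' := S.summand φ)
        ((S.component φ).restrictScalars ℂ ∘ₗ (unitMap q M).restrictScalars ℂ)
        (fun m hm => (S.mem_meromorphicV_iff hφ).1 hm)
        (fun m _ => S.mem_above_meromorphicV_iff hφ)
        ((S.isDeligneFiltration_regularV φ).finite_dim (q * b))
    · rw [habove h, Submodule.submoduleOf, Submodule.comap_top]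
      infer_instance
  · rcases hcases with ⟨φ, hφ⟩ | h
    · rw [S.mem_above_meromorphicV_iff hφ] at hna hβ
      have h1 := (S.isDeligneFiltration_regularV φ).eigenvalue _ _
        ((S.mem_meromorphicV_iff hφ).1 hm) hna ((q : ℕ) * β) ?_
      · rw [← Complex.ofReal_natCast, Complex.re_ofReal_mul] at h1
        exact mul_left_cancel₀ hq.ne' h1
      · have h2 := Submodule.smul_mem _ ((q : ℕ) : ℂ) hβ
        rw [map_sub, map_sub, unitMap_complex_smul, smul_sub, S.component_unitMap_euler hφ] at h2
        convert h2 using 2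
        rw [mul_smul]
        congr 1
        exact (map_smul ((S.component φ).restrictScalars ℂ) β _).symm
    · rw [habove h] at hna
      exact absurd trivial hna

end ElementaryModel

end Connection

end MeroConn

end

theorem mainTheorem5 {M : Type*} [AddCommGroup M] [Module ℂ M] [Module MeroConn.ConvLaurent M]
    [IsScalarTower ℂ MeroConn.ConvLaurent M] [Module.Finite MeroConn.ConvLaurent M]
    (C : MeroConn.Connection M) (q : ℕ+) (S : C.ElementaryModel q) :
    C.minimalExtension = C.DSpan (MeroConn.above S.parabolic (-1)) := by
  have hV : C.V = S.meromorphicV := S.isDeligneFiltration_meromorphicV.deligne_eq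
  have hle : ∀ b, S.parabolic b ≤ S.meromorphicV b := fun b m hm =>
    S.formalParabolic_le_formalV _ hm
  refine le_antisymm ?_ ?_
  · refine MeroConn.generated_le ?_ (fun a ha m hm => MeroConn.smul_mem_generated ha hm)
      (fun m hm => MeroConn.apply_mem_generated hm)
    rw [hV]
    suffices h : MeroConn.above S.meromorphicV (-1) ≤
      C.DSpan (MeroConn.above S.parabolic (-1)) from h
    refine iSup_le fun b => ?_
    rw [← S.generated_parabolic b]
    refine MeroConn.generated_le (fun m hm => ?_)
      (fun a ha m hm => MeroConn.smul_mem_generated ha hm)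
      (fun m hm => MeroConn.smul_mem_generated MeroConn.ConvLaurent.x_mem
        (MeroConn.apply_mem_generated hm))
    exact MeroConn.subset_generated _ _ (Submodule.mem_iSup_of_mem b hm)
  · rw [MeroConn.Connection.minimalExtension, hV]
    exact MeroConn.generated_mono
      (iSup_mono fun b => hle b : MeroConn.above S.parabolic (-1) ≤ MeroConn.above S.meromorphicV (-1))
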